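/- **Setting.** For each $t\in[0,1]$ let $\nu_t$ be a probability measure on $\overline{\mathbb R}=\mathbb R\cup\{\pm\infty\}$. It defines a binary memoryless symmetric (BMS) channel $W(t)$: the input $x\in\{\pm1\}^N$ produces the output $Y(t)=(x_0Z_0,\dots,x_{N-1}Z_{N-1})$, where $Z_0,\dots,Z_{N-1}$ are i.i.d. with law $\nu_t$ and independent of the input. Entropies are in bits, $\mathrm{mmse}(X\mid Y)=\mathbb E[(X-\mathbb E[X\mid Y])^2]$, and $C(t)$ is the Shannon capacity of $W(t)$, i.e. the supremum of $I(X;Y)$ over all distributions of a single input $X\in\{\pm1\}$ with output $Y$. Let $\mathcal H(t)=H(X_{\mathrm u}\mid Y_{\mathrm u}(t))$ and $\mathcal M(t)=\mathrm{mmse}(X_{\mathrm u}\mid Y_{\mathrm u}(t))$, where $X_{\mathrm u}$ is uniform on $\{\pm1\}$ and $Y_{\mathrm u}(t)$ is its observation through $W(t)$. Assume that - $W(t)$ is stochastically degraded with respect to $W(s)$ whenever $0\le s\le t\le1$, $W(0)$ is perfect (the output determines the input) and $W(1)$ is uninformative (the law of the output does not depend on the input); - $\mathcal H$ is absolutely continuous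 on $[0,1]$; - $\mathcal M(t)=t$ for all $t\in[0,1]$. Let $\mathcal C\subseteq\{0,1\}^N$, $N\ge1$, be a non-empty binary code (not necessarily linear) of rate $R=\frac1N\log_2|\mathcal C|$, and let $X=((-1)^{c_0},\dots,(-1)^{c_{N-1}})$ with $c$ uniform on $\mathcal C$. Assume that the code has transitive symmetry: the group of coordinate permutations that preserve the law of $X$ is transitive on $\{0,\dots,N-1\}$. Let $M(t)=\mathrm{mmse}(X_i\mid Y_{\sim i}(t))$ be the extrinsic MMSE, where $Y_{\sim i}(t)$ is the output vector without its $i$-th entry; by transitivity it is the same for all $i$, and the claims below hold for every $i$. Let $\kappa(t)=\sup_{s\in[t,1]}\mathcal H'(s)\in[0,\infty]$, the supremum being over the points at which $\mathcal H$ is differentiable. Let $h_b(p)=-p\log_2p-(1-p)\log_2(1-p)$, let $h_b^{-1}\colon[0,1]\to[0,1/2]$ be the inverse of its restriction to $[0,1/2]$, and let $\psi(u)=1-(1-2h_b^{-1}(u))^2$ for $u\in[0,1]$. **Claim.** There is a unique $t_R\in[0,1]$ with $C(t_R)=R$, and $t_R\in(0,1)$ if $0<R<1$. The function $M(1-M)$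 is integrable on $[0,1]$. For every $t\in[0,t_R)$ we have $C(t)>R$ and $$M(t)\le\frac{\kappa(t)\int_t^1M(s)(1-M(s))\,ds}{C(t)-R}$$ (with the convention $\infty\cdot0=0$). The function $\psi$ is non-negative and strictly increasing on $[0,1]$, and for every $t\in(t_R,1]$ we have $\int_{t_R}^t\psi(R-C(s))\,ds>0$ and $$M(t)\ge1-\frac{\int_{t_R}^tM(s)(1-M(s))\,ds}{\int_{t_R}^t\psi(R-C(s))\,ds}.$$ -/

import Mathlib

open MeasureTheory ProbabilityTheory Set

noncomputable section

namespace BMS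

/-! ### Estimation and information quantities of random variables -/

/-- Minimum mean-squared error `‖X - E[X | Y]‖₂²` of estimating the real random variable `X`
from the observation `Y`. -/
def mmse {Ω E : Type*} [MeasurableSpace Ω] [mE : MeasurableSpace E] (P : Measure Ω)
    (X : Ω → ℝ) (Y : Ω → E) : ℝ :=
  ∫ ω, (X ω - (P[X | mE.comap Y]) ω) ^ 2 ∂P

/-- Shannon entropy `H(X)`, in bits, of a random variable with a finite alphabet. -/
def entropy {Ω A : Type*} [MeasurableSpace Ω] [Fintype A] (P : Measure Ω) (X : Ω → A) : ℝ :=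
  (∑ a, Real.negMulLog (P.real (X ⁻¹' {a}))) / Real.log 2

/-- Conditional Shannon entropy `H(X | Y)`, in bits: the expectation of the entropy of the
conditional distribution `a ↦ P(X = a | Y)`. -/
def condEntropy {Ω A E : Type*} [MeasurableSpace Ω] [Fintype A] [mE : MeasurableSpace E]
    (P : Measure Ω) (X : Ω → A) (Y : Ω → E) : ℝ :=
  (∫ ω, ∑ a, Real.negMulLog ((P⟦X ⁻¹' {a} | mE.comap Y⟧) ω) ∂P) / Real.log 2

/-- Mutual information `I(X; Y) = H(X) - H(X | Y)`, in bits. -/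
def mutualInfo {Ω A E : Type*} [MeasurableSpace Ω] [Fintype A] [MeasurableSpace E]
    (P : Measure Ω) (X : Ω → A) (Y : Ω → E) : ℝ :=
  entropy P X - condEntropy P X Y

/-! ### A single use of a binary symmetric channel

Code symbols are elements of `Bool` (`false` is `0`, `true` is `1`). The symbol `b` is sent as the
channel input `(-1)^b`. A binary memoryless symmetric channel with output alphabet the extended
reals is given by the law `ν` of its output for the input `+1`: the output for the input `x` is
`x * Z` with `Z` distributed according to `ν`. -/

/-- The channel input `(-1)^b`. -/
def bpsk (b : Bool) : ℝ := if b then -1 else 1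

/-- The channel output `x * z` for the code symbol `b`, where `x = (-1)^b`. -/
def output (b : Bool) (z : EReal) : EReal := (bpsk b : EReal) * z

/-- The transition probability of the channel: law of the output given the code symbol `b`. -/
def transition (ν : Measure EReal) (b : Bool) : Measure EReal := ν.map (output b)

/-- Law of the pair (code symbol, noise) for a code symbol with law `p`. -/
def singleLaw (p : Measure Bool) (ν : Measure EReal) : Measure (Bool × EReal) := p.prod ν

/-- The output of the single channel use, as a random variable on `Bool × EReal`. -/
def singleOutput (ω : Bool × EReal) : EReal := output ω.1 ω.2

/-- Uniform distribution on the two code symbols. -/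
def unifBit : Measure Bool := uniformOn Set.univ

/-- Conditional entropy `H(X_u | Y_u)` of a uniform input given the channel output. -/
def chanEntropy (ν : Measure EReal) : ℝ :=
  condEntropy (singleLaw unifBit ν) (fun ω => ω.1) singleOutput

/-- `mmse(X_u | Y_u)` of a uniform input given the channel output. -/
def chanMMSE (ν : Measure EReal) : ℝ :=
  mmse (singleLaw unifBit ν) (fun ω => bpsk ω.1) singleOutput

/-- Shannon capacity: supremum of the mutual information over all input distributions. -/
def capacity (ν : Measure EReal) : ℝ :=
  ⨆ p : ProbabilityMeasure Bool,
    mutualInfo (singleLaw (p : Measure Bool) ν) (fun ω => ω.1) singleOutput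

/-- The channel of `ν'` is (stochastically) degraded with respect to the channel of `ν`: it is the
composition of the channel of `ν` with a further channel. -/
def IsDegraded (ν' ν : Measure EReal) : Prop :=
  ∃ K : Kernel EReal EReal, IsMarkovKernel K ∧
    ∀ b, transition ν' b = (transition ν b).bind K

/-- Perfect channel: the input is determined by the output. -/
def IsPerfect (ν : Measure EReal) : Prop :=
  ∃ φ : EReal → Bool, Measurable φ ∧ ∀ b, ∀ᵐ y ∂(transition ν b), φ y = b

/-- Uninformative channel: the law of the output does not depend on the input. -/
def IsUninformative (ν : Measure EReal) : Prop :=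
  ∀ b b', transition ν b = transition ν b'

/-- The standing assumption on a family of channels with parameter `t ∈ [0,1]`: it is ordered by
degradation from a perfect to an uninformative channel, its entropy function is absolutely
continuous on `[0,1]`, and its MMSE function is the identity. Nothing is required of `ν t` for `t`
outside `[0,1]`. -/
structure IsAdmissibleFamily (ν : ℝ → Measure EReal) : Prop where
  degraded : ∀ s t, 0 ≤ s → s ≤ t → t ≤ 1 → IsDegraded (ν t) (ν s)
  perfect : IsPerfect (ν 0)
  uninformative : IsUninformative (ν 1)
  absolutelyContinuous : AbsolutelyContinuousOnInterval (fun t => chanEntropy (ν t)) 0 1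
  mmse_eq : ∀ t ∈ Icc (0 : ℝ) 1, chanMMSE (ν t) = t

/-- `κ(t) = sup_{s ∈ [t,1]} 𝓗'(s)`, with values in `[0,∞]`, where `𝓗` is the entropy function on
`[0,1]`. As `𝓗` is non-decreasing, points where it is not differentiable (which contribute the
value `0`) do not affect the supremum. -/
def kappa (ν : ℝ → Measure EReal) (t : ℝ) : ENNReal :=
  ⨆ s ∈ Icc t 1, ENNReal.ofReal (derivWithin (fun u => chanEntropy (ν u)) (Icc 0 1) s)

/-! ### Codes -/

variable {N : ℕ}

/-- Rate of a binary code of length `N`. -/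
def rate (C : Finset (Fin N → Bool)) : ℝ := Real.logb 2 C.card / N

/-- Uniform distribution on the codewords. -/
def codeLaw (C : Finset (Fin N → Bool)) : Measure (Fin N → Bool) :=
  uniformOn (C : Set (Fin N → Bool))

/-- A random vector with law `μ` has transitive symmetry: the permutations of the coordinates that
preserve its law act transitively. -/
def HasTransitiveSymmetry (μ : Measure (Fin N → Bool)) : Prop :=
  ∀ i j : Fin N, ∃ π : Equiv.Perm (Fin N), μ.map (fun x k => x (π k)) = μ ∧ π i = j

/-- Law of (codeword, noise vector): a uniform codeword and an independent noise vector with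
independent entries of law `ν`. -/
def blockLaw (C : Finset (Fin N → Bool)) (ν : Measure EReal) :
    Measure ((Fin N → Bool) × (Fin N → EReal)) :=
  (codeLaw C).prod (Measure.pi fun _ => ν)

/-- The channel outputs `Y_j = X_j * Z_j` at all positions `j ≠ i`. -/
def extrinsicOutput (i : Fin N) (ω : (Fin N → Bool) × (Fin N → EReal)) : {j // j ≠ i} → EReal :=
  fun j => output (ω.1 j) (ω.2 j)

/-- Extrinsic MMSE `M_i = ‖X_i - E[X_i | Y_{∼i}]‖₂²`. -/
def extrinsicMMSE (C : Finset (Fin N → Bool)) (ν : Measure EReal) (i : Fin N) : ℝ :=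
  mmse (blockLaw C ν) (fun ω => bpsk (ω.1 i)) (extrinsicOutput i)

/-! ### The function `ψ` -/

/-- Binary entropy function, in bits. -/
def hb (p : ℝ) : ℝ := -p * Real.logb 2 p - (1 - p) * Real.logb 2 (1 - p)

/-- Inverse of the bijection `hb : [0,1/2] → [0,1]`. -/
def hbInv (u : ℝ) : ℝ := Function.invFunOn hb (Icc 0 (1 / 2)) u

/-- `ψ(u) = 1 - (1 - 2 h_b⁻¹(u))²`, used for `u ∈ [0,1]`. -/
def psi (u : ℝ) : ℝ := 1 - (1 - 2 * hbInv u) ^ 2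

end BMS

end

namespace BMS

open Real Function

/-! Each channel is reduced to the law on [-1,1] of the posterior mean D of a uniform input. This
law is symmetric. Given the symbol b, the output has density 1 + (-1)^b D relative to the output law
of a uniform input. So entropy, MMSE and capacity of one use, and entropy and extrinsic MMSE of the
code, are integrals of explicit functions of independent biases. Degradation makes the new bias a
conditional expectation of the old one, so by Jensen integrals of concave functions grow
(`lessNoisy_biasLaw`).

Let B be `biasEnt`, and let τ be the posterior mean of symbol i given the other outputs. Replacing
the bias law at position i by a degraded one changes the block entropy by the average over the other
outputs of the increment of E[B(D) - B(τD)] (`blockEnt_update_sub`). Three facts about B control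
this increment. (a) The map d ↦ τ² B(d) - B(τd) is concave, so the increment is at least (1 - τ²)
times that of E[B(D)]; averaging turns 1 - τ² into the extrinsic MMSE. (b) The map d ↦ B(τd) is
concave, so the increment is at most that of E[B(D)]. (c) Starting from a perfect observation, the
increment is at most log 2 + B(τ), and concavity of w ↦ B(√w) bounds its average by a function of
the MMSE alone.

Degrading the positions one at a time, with the MMSE monotone along the way, and using transitivity,
one gets for the conditional entropy rate h of the code and the entropy H of the channel, when s ≤
t: M(s)(H(t) - H(s)) ≤ h(t) - h(s) ≤ H(t) - H(s), and h(t) ≤ ψ⁻¹(M(t)), with h(0) = 0 and h(1) = R.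

Below the threshold, the first inequality bounds the increments of H - h by those of κ ∫ (1 - M), so
C(t) - R ≤ κ(t) ∫_t^1 (1 - M); multiplying by M(t) ≤ M(s) gives the first bound. Above it, the other
two give R - C(t) ≤ h(t) ≤ ψ⁻¹(M(t)), so ψ(R - C) ≤ M. Integrating and using (1 - M(t)) ∫ M ≤ ∫ M(1
- M) gives the second bound. -/

/-- Entropy, in nats, of a `±1`-valued random variable with mean `d`, minus `log 2`. -/
noncomputable def biasEnt (d : ℝ) : ℝ := (negMulLog (1 + d) + negMulLog (1 - d)) / 2

@[fun_prop]
lemma continuous_biasEnt : Continuous biasEnt := by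
  unfold biasEnt; fun_prop

@[simp]
lemma biasEnt_zero : biasEnt 0 = 0 := by simp [biasEnt]

@[simp]
lemma biasEnt_neg (d : ℝ) : biasEnt (-d) = biasEnt d := by
  simp [biasEnt, add_comm, sub_eq_add_neg]

@[simp]
lemma biasEnt_one : biasEnt 1 = -log 2 := by
  simp only [biasEnt, negMulLog]; norm_num; ring

lemma biasEnt_sqrt_sq (d : ℝ) : biasEnt (√(d ^ 2)) = biasEnt d := by
  rw [sqrt_sq_eq_abs]
  rcases abs_choice d with h | h <;> simp [h]

/-! ### Concavity properties of the bias entropy. -/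

lemma hasDerivAt_biasEnt {d : ℝ} (hd : d ∈ Ioo (-1 : ℝ) 1) :
    HasDerivAt biasEnt ((log (1 - d) - log (1 + d)) / 2) d := by
  have h1 : HasDerivAt (fun x : ℝ => negMulLog (1 + x)) ((-log (1 + d) - 1) * 1) d :=
    (hasDerivAt_negMulLog (by linarith [hd.1] : (1 : ℝ) + d ≠ 0)).comp d
      ((hasDerivAt_id d).const_add 1)
  have h2 : HasDerivAt (fun x : ℝ => negMulLog (1 - x)) ((-log (1 - d) - 1) * (-1)) d :=
    (hasDerivAt_negMulLog (by linarith [hd.2] : (1 : ℝ) - d ≠ 0)).comp d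
      ((hasDerivAt_id d).const_sub 1)
  exact ((h1.add h2).div_const 2).congr_deriv (by ring)

lemma hasDerivAt_deriv_biasEnt {d : ℝ} (hd : d ∈ Ioo (-1 : ℝ) 1) :
    HasDerivAt (fun d => (log (1 - d) - log (1 + d)) / 2) (-(1 / (1 - d ^ 2))) d := by
  have p1 : (1 : ℝ) + d ≠ 0 := by linarith [hd.1]
  have p2 : (1 : ℝ) - d ≠ 0 := by linarith [hd.2]
  have h1 := ((hasDerivAt_id d).const_add 1).log p1
  have h2 := ((hasDerivAt_id d).const_sub 1).log p2
  refine ((h2.sub h1).div_const 2).congr_deriv ?_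
  have : (1 : ℝ) - d ^ 2 ≠ 0 := by
    rw [show (1 : ℝ) - d ^ 2 = (1 + d) * (1 - d) by ring]; exact mul_ne_zero p1 p2
  simp only [id]
  field_simp
  ring

lemma mul_mem_Ioo {τ d : ℝ} (hτ : τ ∈ Icc (-1 : ℝ) 1) (hd : d ∈ Ioo (-1 : ℝ) 1) :
    τ * d ∈ Ioo (-1 : ℝ) 1 := by
  rw [mem_Ioo, ← abs_lt, abs_mul]
  have h1 : |τ| ≤ 1 := abs_le.2 hτ
  have h2 : |d| < 1 := abs_lt.2 hd
  nlinarith [abs_nonneg τ, abs_nonneg d]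

/-- The hypothesis says that the second derivative is nonpositive in the open interval, as B'' =
-1/(1 - d²). Continuity extends concavity to the endpoints, where the derivatives blow up. -/
lemma concaveOn_biasEnt_comb {τ a b : ℝ} (hτ : τ ∈ Icc (-1 : ℝ) 1)
    (h : ∀ d ∈ Ioo (-1 : ℝ) 1,
      a * (1 / (1 - d ^ 2)) + b * (τ ^ 2 * (1 / (1 - (τ * d) ^ 2))) ≥ 0) :
    ConcaveOn ℝ (Icc (-1) 1) (fun d => a * biasEnt d + b * biasEnt (τ * d)) := by
  have hc : Continuous (fun d => a * biasEnt d + b * biasEnt (τ * d)) := by fun_prop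
  refine concaveOn_of_hasDerivWithinAt2_nonpos (convex_Icc _ _) hc.continuousOn
    (f' := fun d => a * ((log (1 - d) - log (1 + d)) / 2) +
      b * ((log (1 - τ * d) - log (1 + τ * d)) / 2 * τ))
    (f'' := fun d => a * (-(1 / (1 - d ^ 2))) + b * (-(1 / (1 - (τ * d) ^ 2)) * τ * τ)) ?_ ?_ ?_
  all_goals
    rw [interior_Icc]
    intro d hd
    have hl : HasDerivAt (fun d : ℝ => τ * d) τ d := by
      simpa using (hasDerivAt_id d).const_mul τ
  · exact (((hasDerivAt_biasEnt hd).const_mul a).add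
      (((hasDerivAt_biasEnt (mul_mem_Ioo hτ hd)).comp d hl).const_mul b)).hasDerivWithinAt
  · exact (((hasDerivAt_deriv_biasEnt hd).const_mul a).add
      ((((hasDerivAt_deriv_biasEnt (mul_mem_Ioo hτ hd)).comp d hl).mul_const τ).const_mul
        b)).hasDerivWithinAt
  · have := h d hd
    nlinarith

lemma one_sub_sq_pos {d : ℝ} (hd : d ∈ Ioo (-1 : ℝ) 1) : 0 < 1 - d ^ 2 := by
  nlinarith [hd.1, hd.2]

lemma concaveOn_biasEnt_mul {τ : ℝ} (hτ : τ ∈ Icc (-1 : ℝ) 1) :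
    ConcaveOn ℝ (Icc (-1) 1) (fun d => biasEnt (τ * d)) := by
  have := concaveOn_biasEnt_comb (a := 0) (b := 1) hτ fun d hd => by
    have := one_sub_sq_pos (mul_mem_Ioo hτ hd)
    rw [ge_iff_le, zero_mul, zero_add, one_mul]
    positivity
  simpa using this

lemma concaveOn_biasEnt : ConcaveOn ℝ (Icc (-1) 1) biasEnt := by
  simpa using concaveOn_biasEnt_mul (τ := 1) (by norm_num)

/-- The second derivative is τ² times 1/(1 - τ²d²) - 1/(1 - d²), which is nonpositive because |τd| ≤
|d|. This is the inequality that makes the extrinsic MMSE appear as a lower bound on the entropy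
growth. -/
lemma concaveOn_sq_mul_biasEnt_sub {τ : ℝ} (hτ : τ ∈ Icc (-1 : ℝ) 1) :
    ConcaveOn ℝ (Icc (-1) 1) (fun d => τ ^ 2 * biasEnt d - biasEnt (τ * d)) := by
  have := concaveOn_biasEnt_comb (a := τ ^ 2) (b := -1) hτ fun d hd => by
    have h1 := one_sub_sq_pos hd
    have : 1 / (1 - (τ * d) ^ 2) ≤ 1 / (1 - d ^ 2) := by
      apply one_div_le_one_div_of_le h1
      have : τ ^ 2 ≤ 1 := by nlinarith [hτ.1, hτ.2]
      nlinarith [sq_nonneg d]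
    nlinarith [sq_nonneg τ]
  simpa [sub_eq_add_neg] using this

/-- B'' ≤ -1 on the open interval. This quantitative concavity converts an increase of the MMSE
under degradation into a strict increase of the entropy. -/
lemma concaveOn_biasEnt_add_sq :
    ConcaveOn ℝ (Icc (-1) 1) (fun d => biasEnt d + d ^ 2 / 2) := by
  have hc : Continuous (fun d => biasEnt d + d ^ 2 / 2) := by fun_prop
  refine concaveOn_of_hasDerivWithinAt2_nonpos (convex_Icc _ _) hc.continuousOn
    (f' := fun d => (log (1 - d) - log (1 + d)) / 2 + d)
    (f'' := fun d => -(1 / (1 - d ^ 2)) + 1) ?_ ?_ ?_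
  all_goals
    rw [interior_Icc]
    intro d hd
  · refine HasDerivAt.hasDerivWithinAt ((hasDerivAt_biasEnt hd).add ?_)
    exact ((hasDerivAt_pow 2 d).div_const 2).congr_deriv (by simp)
  · exact ((hasDerivAt_deriv_biasEnt hd).add (hasDerivAt_id d)).hasDerivWithinAt
  · have h1 := one_sub_sq_pos hd
    have : 1 ≤ 1 / (1 - d ^ 2) := by
      rw [le_div_iff₀ h1]; nlinarith [sq_nonneg d]
    linarith

/-- The point τd is the convex combination of d and -d with weights (1 ± τ)/2, and B is even and
concave. -/
lemma biasEnt_le_biasEnt_mul {τ d : ℝ} (hτ : τ ∈ Icc (-1 : ℝ) 1) (hd : d ∈ Icc (-1 : ℝ) 1) :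
    biasEnt d ≤ biasEnt (τ * d) := by
  have hd' : -d ∈ Icc (-1 : ℝ) 1 := ⟨by linarith [hd.2], by linarith [hd.1]⟩
  have h := concaveOn_biasEnt.right hd hd' (by linarith [hτ.1] : 0 ≤ (1 + τ) / 2)
    (by linarith [hτ.2] : 0 ≤ (1 - τ) / 2) (by ring)
  simp only [smul_eq_mul, biasEnt_neg] at h
  rw [show (1 + τ) / 2 * d + (1 - τ) / 2 * -d = τ * d by ring] at h
  linarith

lemma biasEnt_nonpos {d : ℝ} (hd : d ∈ Icc (-1 : ℝ) 1) : biasEnt d ≤ 0 := by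
  simpa using biasEnt_le_biasEnt_mul (τ := 0) (by norm_num) hd

lemma neg_log_two_le_biasEnt {d : ℝ} (hd : d ∈ Icc (-1 : ℝ) 1) : -log 2 ≤ biasEnt d := by
  simpa using biasEnt_le_biasEnt_mul hd (d := 1) (by norm_num)

lemma abs_biasEnt_le {d : ℝ} (hd : d ∈ Icc (-1 : ℝ) 1) : |biasEnt d| ≤ log 2 := by
  rw [abs_le]
  exact ⟨neg_log_two_le_biasEnt hd, (biasEnt_nonpos hd).trans (log_nonneg (by norm_num))⟩

lemma antitoneOn_biasEnt : AntitoneOn biasEnt (Icc 0 1) := by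
  intro x hx y hy hxy
  rcases eq_or_lt_of_le hx.1 with h | h
  · subst h; simpa using biasEnt_nonpos ⟨by linarith [hy.1], hy.2⟩
  · have hy0 : 0 < y := h.trans_le hxy
    have := biasEnt_le_biasEnt_mul (τ := x / y) (d := y)
      ⟨by linarith [div_nonneg hx.1 hy.1], (div_le_one hy0).2 hxy⟩ ⟨by linarith, hy.2⟩
    rwa [div_mul_cancel₀ _ hy0.ne'] at this

/-- The odd power series of the numerator has nonnegative coefficients; after division by x every
term is still increasing. -/
lemma monotoneOn_log_ratio_div :
    MonotoneOn (fun x : ℝ => (log (1 + x) - log (1 - x)) / x) (Ioo 0 1) := by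
  intro x hx y hy hxy
  have hs : ∀ z ∈ Ioo (0 : ℝ) 1,
      HasSum (fun k : ℕ => 2 * (1 / (2 * (k : ℝ) + 1)) * z ^ (2 * k + 1) / z)
        ((log (1 + z) - log (1 - z)) / z) := fun z hz =>
    (hasSum_log_sub_log_of_abs_lt_one (abs_lt.2 ⟨by linarith [hz.1], hz.2⟩)).div_const z
  refine hasSum_le (fun k => ?_) (hs x hx) (hs y hy)
  have hx0 := hx.1
  have hy0 := hy.1
  rw [pow_succ, pow_succ, ← mul_assoc, ← mul_assoc, mul_div_cancel_right₀ _ hx0.ne',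
    mul_div_cancel_right₀ _ hy0.ne']
  gcongr

/-- The derivative in w is a negative multiple of the ratio in `monotoneOn_log_ratio_div` at √w, so
it decreases. This allows Jensen in the squared posterior mean, the quantity that the MMSE averages.
-/
lemma concaveOn_biasEnt_sqrt : ConcaveOn ℝ (Icc 0 1) (fun w => biasEnt (√w)) := by
  have hc : Continuous (fun w => biasEnt (√w)) := by fun_prop
  have hd : ∀ w ∈ Ioo (0 : ℝ) 1, HasDerivAt (fun w => biasEnt (√w))
      (-((log (1 + √w) - log (1 - √w)) / √w) / 4) w := by
    intro w hw
    have h0 := sqrt_pos.2 hw.1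
    have h1 : √w < 1 := by rw [sqrt_lt' one_pos]; simpa using hw.2
    refine ((hasDerivAt_biasEnt ⟨by linarith, h1⟩).comp w (hasDerivAt_sqrt hw.1.ne')).congr_deriv ?_
    field_simp
    ring
  refine AntitoneOn.concaveOn_of_deriv (convex_Icc _ _) hc.continuousOn ?_ ?_
  · rw [interior_Icc]
    exact fun w hw => (hd w hw).differentiableAt.differentiableWithinAt
  · rw [interior_Icc]
    intro v hv w hw hvw
    rw [(hd v hv).deriv, (hd w hw).deriv]
    have hm : ∀ w ∈ Ioo (0 : ℝ) 1, √w ∈ Ioo (0 : ℝ) 1 := fun w hw =>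
      ⟨sqrt_pos.2 hw.1, by rw [sqrt_lt' one_pos]; simpa using hw.2⟩
    have := monotoneOn_log_ratio_div (hm v hv) (hm w hw) (sqrt_le_sqrt hvw)
    simp only at this
    linarith

/-! ### Binary entropy in bits -/

lemma hb_eq (p : ℝ) : hb p = binEntropy p / log 2 := by
  rw [binEntropy_eq_negMulLog_add_negMulLog_one_sub, hb, logb, logb, negMulLog, negMulLog]
  ring

lemma hb_bias (d : ℝ) :
    hb ((1 - d) / 2) = 1 + biasEnt d / log 2 := by
  have hl : log 2 ≠ 0 := (log_pos (by norm_num)).ne'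
  have h : ∀ x : ℝ, negMulLog (x / 2) = (negMulLog x + x * log 2) / 2 := by
    intro x
    rw [div_eq_mul_inv, negMulLog_mul]
    simp only [negMulLog, log_inv]
    ring
  rw [hb_eq, binEntropy_eq_negMulLog_add_negMulLog_one_sub,
    show 1 - (1 - d) / 2 = (1 + d) / 2 by ring, h, h, biasEnt]
  field_simp
  ring

lemma strictMonoOn_hb : StrictMonoOn hb (Icc 0 (1 / 2)) := by
  intro x hx y hy hxy
  rw [hb_eq, hb_eq]
  rw [one_div] at hx hy
  exact div_lt_div_of_pos_right (binEntropy_strictMonoOn hx hy hxy) (log_pos (by norm_num))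

lemma hb_zero : hb 0 = 0 := by simp [hb]

lemma hb_half : hb (1 / 2) = 1 := by
  rw [hb_eq, one_div, binEntropy_two_inv, div_self (log_pos (by norm_num)).ne']

lemma surjOn_hb : SurjOn hb (Icc 0 (1 / 2)) (Icc 0 1) := by
  have hc : Continuous hb := by
    rw [show hb = fun p => binEntropy p / log 2 from funext hb_eq]
    fun_prop
  have := intermediate_value_Icc (by norm_num : (0 : ℝ) ≤ 1 / 2) hc.continuousOn
  rwa [hb_zero, hb_half] at this

lemma hbInv_mem {u : ℝ} (hu : u ∈ Icc (0 : ℝ) 1) : hbInv u ∈ Icc (0 : ℝ) (1 / 2) :=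
  Function.invFunOn_mem (surjOn_hb hu)

lemma hb_hbInv {u : ℝ} (hu : u ∈ Icc (0 : ℝ) 1) : hb (hbInv u) = u :=
  Function.invFunOn_eq (surjOn_hb hu)

lemma hbInv_hb {p : ℝ} (hp : p ∈ Icc (0 : ℝ) (1 / 2)) : hbInv (hb p) = p :=
  strictMonoOn_hb.injOn.leftInvOn_invFunOn hp

lemma strictMonoOn_hbInv : StrictMonoOn hbInv (Icc 0 1) := by
  intro x hx y hy hxy
  by_contra! h
  have := strictMonoOn_hb.monotoneOn (hbInv_mem hy) (hbInv_mem hx) h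
  rw [hb_hbInv hx, hb_hbInv hy] at this
  linarith

lemma strictMonoOn_psi : StrictMonoOn psi (Icc 0 1) := by
  intro x hx y hy hxy
  have h := strictMonoOn_hbInv hx hy hxy
  have h1 := (hbInv_mem hx).1
  have h2 := (hbInv_mem hy).2
  simp only [psi]
  nlinarith

lemma psi_nonneg {u : ℝ} (hu : u ∈ Icc (0 : ℝ) 1) : 0 ≤ psi u := by
  have h := hbInv_mem hu
  simp only [psi]
  nlinarith [h.1, h.2]

/-- `psi` inverts the entropy, in bits, as a function of the mean-squared error `m`. -/
lemma psi_biasEnt {m : ℝ} (hm : m ∈ Icc (0 : ℝ) 1) :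
    psi (1 + biasEnt (√(1 - m)) / log 2) = m := by
  have h0 := sqrt_nonneg (1 - m)
  have h1 : √(1 - m) ≤ 1 := by rw [sqrt_le_one]; linarith [hm.1]
  rw [← hb_bias, psi, hbInv_hb ⟨by linarith, by linarith⟩,
    show 1 - 2 * ((1 - √(1 - m)) / 2) = √(1 - m) by ring, sq_sqrt (by linarith [hm.2])]
  ring

/-! ### Laws of biases -/

/-- The interval `[-1,1]` of possible posterior means of a channel input. -/
abbrev Bias : Type := ↥(Icc (-1 : ℝ) 1)

/-- A law on `[-1,1]` that is invariant under the reflection `d ↦ -d`. -/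
def IsSymmetricLaw (m : Measure Bias) : Prop :=
  ∀ f : ℝ → ℝ, Continuous f → ∫ d, f (-(d : ℝ)) ∂m = ∫ d, f (d : ℝ) ∂m

/-- The order on laws of posterior means induced by degradation: `m'` is less informative
than `m`. -/
def LessNoisy (m m' : Measure Bias) : Prop :=
  ∀ f : ℝ → ℝ, ConcaveOn ℝ (Icc (-1) 1) f → ContinuousOn f (Icc (-1) 1) →
    ∫ d, f (d : ℝ) ∂m ≤ ∫ d, f (d : ℝ) ∂m'

lemma integrable_of_continuous {X : Type*} [TopologicalSpace X] [CompactSpace X]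
    [MeasurableSpace X] [OpensMeasurableSpace X] (μ : Measure X) [IsFiniteMeasure μ] {f : X → ℝ}
    (hf : Continuous f) : Integrable f μ :=
  hf.integrable_of_hasCompactSupport (HasCompactSupport.of_compactSpace f)

lemma IsSymmetricLaw.integral_eq {m : Measure Bias} [IsProbabilityMeasure m]
    (hm : IsSymmetricLaw m) {f : ℝ → ℝ} (hf : Continuous f) :
    ∫ d, f (d : ℝ) ∂m = ∫ d : Bias, (f d + f (-d)) / 2 ∂m := by
  have h1 : Integrable (fun d : Bias => f d) m := integrable_of_continuous m (by fun_prop)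
  have h2 : Integrable (fun d : Bias => f (-d)) m := integrable_of_continuous m (by fun_prop)
  rw [integral_div, integral_add h1 h2, hm f hf]
  ring

lemma IsSymmetricLaw.integral_id {m : Measure Bias} (hm : IsSymmetricLaw m) :
    ∫ d, (d : ℝ) ∂m = 0 := by
  have := hm id continuous_id
  simp only [id, integral_neg] at this
  linarith

/-! ### Resampling one coordinate of a product measure -/

section Resample

variable {ι E : Type*} [DecidableEq ι] [MeasurableSpace E]

lemma isProbabilityMeasure_update (θ : ι → Measure E) [hθ : ∀ j, IsProbabilityMeasure (θ j)]
    (i : ι) (m : Measure E) [hm : IsProbabilityMeasure m] (j : ι) :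
    IsProbabilityMeasure (update θ i m j) := by
  by_cases h : j = i
  · subst h; simpa using hm
  · simpa [h] using hθ j

variable [Fintype ι]

/-- The law `θ i` is discarded: the i-th coordinate is overwritten by an independent draw from `m`.
Comparing two laws at one position thus becomes a comparison under a common law of the rest. -/
lemma measurePreserving_update (θ : ι → Measure E) [∀ j, IsProbabilityMeasure (θ j)]
    (i : ι) (m : Measure E) [IsProbabilityMeasure m] :
    MeasurePreserving (fun q : (ι → E) × E => update q.1 i q.2)
      ((Measure.pi θ).prod m) (Measure.pi (update θ i m)) := by
  have := isProbabilityMeasure_update θ i m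
  have hmeas : Measurable (fun q : (ι → E) × E => update q.1 i q.2) := by
    rw [measurable_pi_iff]
    intro j
    by_cases h : j = i
    · subst h; simpa using measurable_snd
    · simpa [h, Function.comp_def] using (measurable_pi_apply j).comp measurable_fst
  refine ⟨hmeas, Eq.symm (Measure.pi_eq fun s hs => ?_)⟩
  rw [Measure.map_apply hmeas (MeasurableSet.univ_pi hs)]
  -- The old i-th coordinate is unconstrained, so its factor is `univ`.
  have : (fun q : (ι → E) × E => update q.1 i q.2) ⁻¹' (univ.pi s) =
      (univ.pi (update s i univ)) ×ˢ s i := by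
    ext q
    simp only [mem_preimage, mem_pi, mem_univ, true_imp_iff, mem_prod]
    constructor
    · intro h
      refine ⟨fun j => ?_, by simpa using h i⟩
      by_cases hj : j = i
      · subst hj; simp
      · simpa [hj] using h j
    · rintro ⟨h, hi⟩ j
      by_cases hj : j = i
      · subst hj; simpa using hi
      · simpa [hj] using h j
  rw [this, Measure.prod_prod, Measure.pi_pi, ← Finset.prod_erase_mul _ _ (Finset.mem_univ i),
    ← Finset.prod_erase_mul _ _ (Finset.mem_univ i)]
  simp only [update_self, measure_univ, mul_one]
  congr 1
  refine Finset.prod_congr rfl fun j hj => ?_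
  rw [update_of_ne (Finset.ne_of_mem_erase hj), update_of_ne (Finset.ne_of_mem_erase hj)]

variable [TopologicalSpace E] [CompactSpace E] [SecondCountableTopology E] [BorelSpace E]

lemma integrable_update (θ : ι → Measure E) [∀ j, IsProbabilityMeasure (θ j)]
    (i : ι) (m : Measure E) [IsProbabilityMeasure m] {G : (ι → E) → ℝ} (hG : Continuous G) :
    Integrable (fun q : (ι → E) × E => G (update q.1 i q.2)) ((Measure.pi θ).prod m) :=
  integrable_of_continuous _ (hG.comp (continuous_fst.update i continuous_snd))

lemma integral_pi_update (θ : ι → Measure E) [∀ j, IsProbabilityMeasure (θ j)]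
    (i : ι) (m : Measure E) [IsProbabilityMeasure m] {G : (ι → E) → ℝ} (hG : Continuous G) :
    ∫ d, G d ∂Measure.pi (update θ i m) = ∫ d, ∫ u, G (update d i u) ∂m ∂Measure.pi θ := by
  rw [← (measurePreserving_update θ i m).map_eq,
    integral_map (measurePreserving_update θ i m).measurable.aemeasurable
      hG.aestronglyMeasurable, integral_prod _ (integrable_update θ i m hG)]

lemma integral_pi_update_mono (θ : ι → Measure E) [∀ j, IsProbabilityMeasure (θ j)]
    (i : ι) (m m' : Measure E) [IsProbabilityMeasure m] [IsProbabilityMeasure m']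
    {G : (ι → E) → ℝ} (hG : Continuous G)
    (h : ∀ d, ∫ u, G (update d i u) ∂m ≤ ∫ u, G (update d i u) ∂m') :
    ∫ d, G d ∂Measure.pi (update θ i m) ≤ ∫ d, G d ∂Measure.pi (update θ i m') := by
  rw [integral_pi_update θ i m hG, integral_pi_update θ i m' hG]
  exact integral_mono (integrable_update θ i m hG).integral_prod_left
    (integrable_update θ i m' hG).integral_prod_left h

end Resample

/-! ### Likelihoods as functions of the biases -/

lemma bpsk_mul_self (b : Bool) : bpsk b * bpsk b = 1 := by cases b <;> simp [bpsk]

lemma bpsk_cases (b : Bool) : bpsk b = 1 ∨ bpsk b = -1 := by cases b <;> simp [bpsk]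

lemma one_add_bpsk_mul_nonneg (b : Bool) {d : ℝ} (hd : d ∈ Icc (-1 : ℝ) 1) :
    0 ≤ 1 + bpsk b * d := by
  rcases bpsk_cases b with h | h <;> rw [h] <;> linarith [hd.1, hd.2]

section Block

variable {ι : Type*}

/-- The vector of real numbers underlying a vector of biases. -/
def toVec (d : ι → Bias) : ι → ℝ := fun j => d j

@[fun_prop]
lemma continuous_toVec : Continuous (toVec (ι := ι)) := by unfold toVec; fun_prop

/-- Likelihood of the codeword `x`, given biases `d` at the positions in `s`. -/
noncomputable def lik (s : Finset ι) (x : ι → Bool) (d : ι → ℝ) : ℝ :=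
  ∏ j ∈ s, (1 + bpsk (x j) * d j)

lemma lik_nonneg (s : Finset ι) (x : ι → Bool) {d : ι → ℝ} (hd : ∀ j, d j ∈ Icc (-1 : ℝ) 1) :
    0 ≤ lik s x d :=
  Finset.prod_nonneg fun j _ => one_add_bpsk_mul_nonneg (x j) (hd j)

@[fun_prop]
lemma continuous_lik (s : Finset ι) (x : ι → Bool) : Continuous (lik s x) := by
  unfold lik; fun_prop

variable [DecidableEq ι]

lemma lik_update_of_mem {s : Finset ι} {i : ι} (hi : i ∈ s) (x : ι → Bool) (d : ι → ℝ) (u : ℝ) :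
    lik s x (update d i u) = lik (s.erase i) x d * (1 + bpsk (x i) * u) := by
  rw [lik, ← Finset.prod_erase_mul _ _ hi, update_self]
  congr 1
  exact Finset.prod_congr rfl fun j hj => by rw [update_of_ne (Finset.ne_of_mem_erase hj)]

lemma lik_update_of_notMem {s : Finset ι} {i : ι} (hi : i ∉ s) (x : ι → Bool) (d : ι → ℝ)
    (u : ℝ) : lik s x (update d i u) = lik s x d :=
  Finset.prod_congr rfl fun j hj => by rw [update_of_ne (ne_of_mem_of_not_mem hj hi)]

variable [Fintype ι]

/-- Total likelihood under the prior `p`. -/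
noncomputable def evidence (p : (ι → Bool) → ℝ) (s : Finset ι) (d : ι → ℝ) : ℝ :=
  ∑ x, p x * lik s x d

/-- Unnormalized posterior mean of the symbol `i` under the prior `p`. -/
noncomputable def corr (p : (ι → Bool) → ℝ) (s : Finset ι) (i : ι) (d : ι → ℝ) : ℝ :=
  ∑ x, p x * bpsk (x i) * lik s x d

@[fun_prop]
lemma continuous_evidence (p : (ι → Bool) → ℝ) (s : Finset ι) : Continuous (evidence p s) := by
  unfold evidence; fun_prop

@[fun_prop]
lemma continuous_corr (p : (ι → Bool) → ℝ) (s : Finset ι) (i : ι) : Continuous (corr p s i) := by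
  unfold corr; fun_prop

lemma evidence_nonneg {p : (ι → Bool) → ℝ} (hp : ∀ x, 0 ≤ p x) (s : Finset ι) {d : ι → ℝ}
    (hd : ∀ j, d j ∈ Icc (-1 : ℝ) 1) : 0 ≤ evidence p s d :=
  Finset.sum_nonneg fun x _ => mul_nonneg (hp x) (lik_nonneg s x hd)

lemma abs_corr_le {p : (ι → Bool) → ℝ} (hp : ∀ x, 0 ≤ p x) (s : Finset ι) (i : ι) {d : ι → ℝ}
    (hd : ∀ j, d j ∈ Icc (-1 : ℝ) 1) : |corr p s i d| ≤ evidence p s d := by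
  refine (Finset.abs_sum_le_sum_abs _ _).trans (Finset.sum_le_sum fun x _ => ?_)
  have : |bpsk (x i)| = 1 := by rcases bpsk_cases (x i) with h | h <;> simp [h]
  rw [abs_mul, abs_mul, this, abs_of_nonneg (hp x), abs_of_nonneg (lik_nonneg s x hd), mul_one]

lemma evidence_update_of_notMem (p : (ι → Bool) → ℝ) {s : Finset ι} {i : ι} (hi : i ∉ s)
    (d : ι → ℝ) (u : ℝ) : evidence p s (update d i u) = evidence p s d := by
  simp only [evidence, lik_update_of_notMem hi]

lemma corr_update_of_notMem (p : (ι → Bool) → ℝ) {s : Finset ι} {i : ι} (hi : i ∉ s) (k : ι)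
    (d : ι → ℝ) (u : ℝ) : corr p s k (update d i u) = corr p s k d := by
  simp only [corr, lik_update_of_notMem hi]

/-- The likelihood is a product of affine factors, so the evidence is affine in each bias; its slope
is the unnormalized posterior mean from the remaining positions. -/
lemma evidence_update_of_mem (p : (ι → Bool) → ℝ) {s : Finset ι} {i : ι} (hi : i ∈ s)
    (d : ι → ℝ) (u : ℝ) :
    evidence p s (update d i u) = evidence p (s.erase i) d + corr p (s.erase i) i d * u := by
  simp only [evidence, corr, lik_update_of_mem hi, Finset.sum_mul, ← Finset.sum_add_distrib]
  exact Finset.sum_congr rfl fun x _ => by ring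

lemma corr_update_of_mem (p : (ι → Bool) → ℝ) {s : Finset ι} {i : ι} (hi : i ∈ s) (k : ι)
    (d : ι → ℝ) (u : ℝ) :
    corr p s k (update d i u) = corr p (s.erase i) k d +
      (∑ x, p x * bpsk (x k) * lik (s.erase i) x d * bpsk (x i)) * u := by
  simp only [corr, lik_update_of_mem hi, Finset.sum_mul, ← Finset.sum_add_distrib]
  exact Finset.sum_congr rfl fun x _ => by ring

/-- Posterior mean of the symbol `i` given the biases at the other positions. -/
noncomputable def postMean (p : (ι → Bool) → ℝ) (i : ι) (d : ι → ℝ) : ℝ :=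
  corr p (Finset.univ.erase i) i d / evidence p (Finset.univ.erase i) d

/-- Density of the mean-squared error of the symbol `i` given the biases at the other positions. -/
noncomputable def errDensity (p : (ι → Bool) → ℝ) (i : ι) (d : ι → ℝ) : ℝ :=
  evidence p (Finset.univ.erase i) d * (1 - postMean p i d ^ 2)

/-- Density of the posterior entropy, in nats, of the codeword given the biases. -/
noncomputable def entDensity (p : (ι → Bool) → ℝ) (d : ι → ℝ) : ℝ :=
  ∑ x, negMulLog (p x * lik Finset.univ x d) - negMulLog (evidence p Finset.univ d)

@[fun_prop]
lemma continuous_entDensity (p : (ι → Bool) → ℝ) : Continuous (entDensity p) := by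
  unfold entDensity; fun_prop

lemma postMean_mem {p : (ι → Bool) → ℝ} (hp : ∀ x, 0 ≤ p x) (i : ι) {d : ι → ℝ}
    (hd : ∀ j, d j ∈ Icc (-1 : ℝ) 1) : postMean p i d ∈ Icc (-1 : ℝ) 1 := by
  rw [mem_Icc, ← abs_le, postMean, abs_div, abs_of_nonneg (evidence_nonneg hp _ hd)]
  exact div_le_one_of_le₀ (abs_corr_le hp _ i hd) (evidence_nonneg hp _ hd)

/-- When the evidence vanishes, |corr| ≤ evidence makes the numerator vanish too, so the default
value of the quotient does no harm. -/
lemma evidence_mul_postMean {p : (ι → Bool) → ℝ} (hp : ∀ x, 0 ≤ p x) (i : ι) {d : ι → ℝ}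
    (hd : ∀ j, d j ∈ Icc (-1 : ℝ) 1) :
    evidence p (Finset.univ.erase i) d * postMean p i d = corr p (Finset.univ.erase i) i d := by
  have h := abs_corr_le hp (Finset.univ.erase i) i hd
  by_cases h0 : evidence p (Finset.univ.erase i) d = 0
  · rw [h0] at h ⊢
    rw [abs_nonpos_iff.1 h, zero_mul]
  · rw [postMean, mul_div_cancel₀ _ h0]

lemma errDensity_nonneg {p : (ι → Bool) → ℝ} (hp : ∀ x, 0 ≤ p x) (i : ι) {d : ι → ℝ}
    (hd : ∀ j, d j ∈ Icc (-1 : ℝ) 1) : 0 ≤ errDensity p i d := by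
  have h := postMean_mem hp i hd
  exact mul_nonneg (evidence_nonneg hp _ hd) (by nlinarith [h.1, h.2])

lemma errDensity_eq {p : (ι → Bool) → ℝ} (i : ι) {d : ι → ℝ} :
    errDensity p i d = evidence p (Finset.univ.erase i) d -
      corr p (Finset.univ.erase i) i d ^ 2 / evidence p (Finset.univ.erase i) d := by
  by_cases h0 : evidence p (Finset.univ.erase i) d = 0
  · simp [errDensity, h0]
  · rw [errDensity, postMean]
    field_simp

/-! ### Concavity and continuity of q - s²/q. -/

/-- At a zero of Q the quotient is squeezed by 0 ≤ S²/Q ≤ Q. The error density is therefore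
continuous although the posterior mean need not be. -/
lemma continuous_sub_sq_div {X : Type*} [TopologicalSpace X] {S Q : X → ℝ} (hS : Continuous S)
    (hQ : Continuous Q) (h : ∀ x, |S x| ≤ Q x) : Continuous (fun x => Q x - S x ^ 2 / Q x) := by
  refine hQ.sub (continuous_iff_continuousAt.2 fun x => ?_)
  by_cases h0 : Q x = 0
  · rw [ContinuousAt, h0, div_zero]
    refine squeeze_zero (fun y => ?_) (fun y => ?_) (h0 ▸ hQ.tendsto x)
    · exact div_nonneg (sq_nonneg _) ((abs_nonneg _).trans (h y))
    · have hq := (abs_nonneg _).trans (h y)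
      refine div_le_of_le_mul₀ hq hq ?_
      rw [← sq_abs]
      nlinarith [h y, abs_nonneg (S y)]
  · exact (hS.continuousAt.pow 2).div hQ.continuousAt h0

/-- Joint convexity of s²/q. After writing s = qτ, which is possible even at q = 0, the gap with
denominators cleared is a b q₁ q₂ (τ₁ - τ₂)². -/
lemma sq_div_comb_le {a b s₁ s₂ q₁ q₂ : ℝ} (ha : 0 ≤ a) (hb : 0 ≤ b) (h₁ : |s₁| ≤ q₁)
    (h₂ : |s₂| ≤ q₂) :
    (a * s₁ + b * s₂) ^ 2 / (a * q₁ + b * q₂) ≤ a * (s₁ ^ 2 / q₁) + b * (s₂ ^ 2 / q₂) := by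
  have key : ∀ s q : ℝ, |s| ≤ q → ∃ τ, s = q * τ ∧ s ^ 2 / q = q * τ ^ 2 := by
    intro s q h
    by_cases h0 : q = 0
    · subst h0
      exact ⟨0, by simpa using abs_nonpos_iff.1 h, by simp⟩
    · exact ⟨s / q, by field_simp, by field_simp⟩
  obtain ⟨τ₁, e₁, f₁⟩ := key s₁ q₁ h₁
  obtain ⟨τ₂, e₂, f₂⟩ := key s₂ q₂ h₂
  have hq₁ : 0 ≤ q₁ := (abs_nonneg _).trans h₁
  have hq₂ : 0 ≤ q₂ := (abs_nonneg _).trans h₂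
  rw [f₁, f₂, e₁, e₂]
  refine div_le_of_le_mul₀ (by positivity) (by positivity) ?_
  have : 0 ≤ (a * q₁) * (b * q₂) * (τ₁ - τ₂) ^ 2 := by positivity
  nlinarith

lemma concaveOn_sub_sq_div {a b a' b' : ℝ} (h : ∀ u ∈ Icc (-1 : ℝ) 1, |a' + b' * u| ≤ a + b * u) :
    ConcaveOn ℝ (Icc (-1) 1) (fun u => (a + b * u) - (a' + b' * u) ^ 2 / (a + b * u)) := by
  refine ⟨convex_Icc _ _, fun u hu v hv α β hα hβ hαβ => ?_⟩
  have := sq_div_comb_le hα hβ (h u hu) (h v hv)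
  rw [show α * (a' + b' * u) + β * (a' + b' * v) = (α + β) * a' + b' * (α * u + β * v) by ring,
    show α * (a + b * u) + β * (a + b * v) = (α + β) * a + b * (α * u + β * v) by ring, hαβ,
    one_mul, one_mul] at this
  simp only [smul_eq_mul]
  have e : a + b * (α * u + β * v) = α * (a + b * u) + β * (a + b * v) := by
    linear_combination -a * hαβ
  linarith

lemma continuousOn_sub_sq_div {a b a' b' : ℝ}
    (h : ∀ u ∈ Icc (-1 : ℝ) 1, |a' + b' * u| ≤ a + b * u) :
    ContinuousOn (fun u => (a + b * u) - (a' + b' * u) ^ 2 / (a + b * u)) (Icc (-1) 1) := by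
  rw [continuousOn_iff_continuous_domRestrict]
  exact continuous_sub_sq_div (X := Bias) (S := fun u => a' + b' * u) (Q := fun u => a + b * u)
    (by fun_prop) (by fun_prop) fun u => h u u.2

end Block

/-! ### Block entropy and extrinsic error as integrals over independent biases. -/

section Block

variable {ι : Type*}

lemma toVec_mem (d : ι → Bias) (j : ι) : toVec d j ∈ Icc (-1 : ℝ) 1 := (d j).2

variable [DecidableEq ι]

lemma toVec_update (d : ι → Bias) (i : ι) (u : Bias) :
    toVec (update d i u) = update (toVec d) i (u : ℝ) := by
  ext j
  by_cases h : j = i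
  · subst h; simp [toVec]
  · simp [toVec, h]

variable [Fintype ι]

lemma continuous_errDensity_toVec {p : (ι → Bool) → ℝ} (hp : ∀ x, 0 ≤ p x) (i : ι) :
    Continuous (fun d : ι → Bias => errDensity p i (toVec d)) := by
  simp only [errDensity_eq]
  exact continuous_sub_sq_div (by fun_prop) (by fun_prop) fun d => abs_corr_le hp _ i (toVec_mem d)

/-- Entropy, in nats, of a codeword with law `p` given observations whose biases are independent
with laws `θ`. -/
noncomputable def blockEnt (p : (ι → Bool) → ℝ) (θ : ι → Measure Bias) : ℝ :=
  ∫ d, entDensity p (toVec d) ∂Measure.pi θ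

/-- Mean-squared error of the symbol `i` of a codeword with law `p` given observations at the other
positions whose biases are independent with laws `θ`. -/
noncomputable def blockMMSE (p : (ι → Bool) → ℝ) (i : ι) (θ : ι → Measure Bias) : ℝ :=
  ∫ d, errDensity p i (toVec d) ∂Measure.pi θ

/-- By independence the integral factorizes, and each factor has mean one since a symmetric law has
mean zero. Consequently the evidence is a probability density with respect to the product of bias
laws. -/
lemma integral_lik (s : Finset ι) (x : ι → Bool) (θ : ι → Measure Bias)
    [∀ j, IsProbabilityMeasure (θ j)] (hθ : ∀ j, IsSymmetricLaw (θ j)) :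
    ∫ d, lik s x (toVec d) ∂Measure.pi θ = 1 := by
  have h : ∀ d : ι → Bias, lik s x (toVec d) =
      ∏ j, (if j ∈ s then 1 + bpsk (x j) * (d j : ℝ) else 1) := fun d => by
    rw [Finset.prod_ite_mem, Finset.univ_inter]; rfl
  simp only [h]
  rw [integral_fintype_prod_eq_prod (f := fun j (u : Bias) =>
    if j ∈ s then 1 + bpsk (x j) * (u : ℝ) else 1)]
  refine Finset.prod_eq_one fun j _ => ?_
  split_ifs
  · rw [integral_add (integrable_const _) (integrable_of_continuous _ (by fun_prop)),
      integral_const_mul, (hθ j).integral_id]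
    simp
  · simp

lemma integral_evidence {p : (ι → Bool) → ℝ} (hp1 : ∑ x, p x = 1) (s : Finset ι)
    (θ : ι → Measure Bias) [∀ j, IsProbabilityMeasure (θ j)] (hθ : ∀ j, IsSymmetricLaw (θ j)) :
    ∫ d, evidence p s (toVec d) ∂Measure.pi θ = 1 := by
  simp only [evidence]
  rw [integral_finsetSum _ fun x _ => integrable_of_continuous _ (by fun_prop)]
  simp only [integral_const_mul, integral_lik s _ θ hθ, mul_one, hp1]

lemma blockMMSE_nonneg {p : (ι → Bool) → ℝ} (hp : ∀ x, 0 ≤ p x) (i : ι) (θ : ι → Measure Bias) :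
    0 ≤ blockMMSE p i θ :=
  integral_nonneg fun d => errDensity_nonneg hp i (toVec_mem d)

lemma blockMMSE_le_one {p : (ι → Bool) → ℝ} (hp : ∀ x, 0 ≤ p x) (hp1 : ∑ x, p x = 1) (i : ι)
    (θ : ι → Measure Bias) [∀ j, IsProbabilityMeasure (θ j)] (hθ : ∀ j, IsSymmetricLaw (θ j)) :
    blockMMSE p i θ ≤ 1 := by
  rw [← integral_evidence hp1 (Finset.univ.erase i) θ hθ]
  refine integral_mono (integrable_of_continuous _ (continuous_errDensity_toVec hp i))
    (integrable_of_continuous _ (by fun_prop)) fun d => ?_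
  have := evidence_nonneg hp (Finset.univ.erase i) (toVec_mem d)
  simp only [errDensity]
  nlinarith [mul_nonneg this (sq_nonneg (postMean p i (toVec d)))]

/-! ### Degrading one position -/

/-- As a function of the j-th bias alone, the error density is q - s²/q with q and s affine, hence
concave; for j = i it is constant. -/
lemma blockMMSE_update_mono {p : (ι → Bool) → ℝ} (hp : ∀ x, 0 ≤ p x) (i j : ι)
    (θ : ι → Measure Bias) [∀ j, IsProbabilityMeasure (θ j)] {m m' : Measure Bias}
    [IsProbabilityMeasure m] [IsProbabilityMeasure m'] (h : LessNoisy m m') :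
    blockMMSE p i (update θ j m) ≤ blockMMSE p i (update θ j m') := by
  refine integral_pi_update_mono θ j m m' (continuous_errDensity_toVec hp i) fun d => ?_
  simp only [toVec_update, errDensity_eq]
  by_cases hj : j ∈ Finset.univ.erase i
  · have hb : ∀ u ∈ Icc (-1 : ℝ) 1,
        |corr p (Finset.univ.erase i) i (update (toVec d) j u)| ≤
          evidence p (Finset.univ.erase i) (update (toVec d) j u) := fun u hu => by
      have := abs_corr_le hp (Finset.univ.erase i) i (toVec_mem (update d j ⟨u, hu⟩))
      rwa [toVec_update] at this
    simp only [evidence_update_of_mem p hj, corr_update_of_mem p hj] at hb ⊢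
    exact h _ (concaveOn_sub_sq_div hb) (continuousOn_sub_sq_div hb)
  · simp only [evidence_update_of_notMem p hj, corr_update_of_notMem p hj, integral_const,
      probReal_univ, le_refl]

lemma negMulLog_one_add_bpsk (b : Bool) (u : ℝ) :
    negMulLog (1 + bpsk b * u) + negMulLog (1 + bpsk b * -u) = 2 * biasEnt u := by
  rcases bpsk_cases b with h | h <;> simp only [h, biasEnt] <;> ring_nf

/-- The rule for the negMulLog of a product separates the factor of position i. Averaging over ±u
cancels the linear terms, and all that remains of the code is the evidence and the posterior mean of
symbol i. -/
lemma entDensity_update_symm {p : (ι → Bool) → ℝ} (hp : ∀ x, 0 ≤ p x) (i : ι) {d : ι → ℝ}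
    (hd : ∀ j, d j ∈ Icc (-1 : ℝ) 1) (u : ℝ) :
    (entDensity p (update d i u) + entDensity p (update d i (-u))) / 2 =
      (∑ x, negMulLog (p x * lik (Finset.univ.erase i) x d) -
        negMulLog (evidence p (Finset.univ.erase i) d)) +
      evidence p (Finset.univ.erase i) d * (biasEnt u - biasEnt (postMean p i d * u)) := by
  have hi := Finset.mem_univ i
  have h1 : ∑ x, negMulLog (p x * lik Finset.univ x (update d i u)) +
      ∑ x, negMulLog (p x * lik Finset.univ x (update d i (-u))) =
      2 * ∑ x, negMulLog (p x * lik (Finset.univ.erase i) x d) +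
        evidence p (Finset.univ.erase i) d * (2 * biasEnt u) := by
    rw [← Finset.sum_add_distrib, evidence, Finset.sum_mul, Finset.mul_sum,
      ← Finset.sum_add_distrib]
    refine Finset.sum_congr rfl fun x _ => ?_
    rw [lik_update_of_mem hi, lik_update_of_mem hi, ← mul_assoc, ← mul_assoc,
      ← negMulLog_one_add_bpsk (x i) u]
    generalize p x * lik (Finset.univ.erase i) x d = a
    rw [negMulLog_mul, negMulLog_mul]
    ring
  have h2 : negMulLog (evidence p Finset.univ (update d i u)) +
      negMulLog (evidence p Finset.univ (update d i (-u))) =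
      2 * negMulLog (evidence p (Finset.univ.erase i) d) +
        evidence p (Finset.univ.erase i) d * (2 * biasEnt (postMean p i d * u)) := by
    rw [evidence_update_of_mem p hi, evidence_update_of_mem p hi,
      ← evidence_mul_postMean hp i hd]
    set q := evidence p (Finset.univ.erase i) d
    set τ := postMean p i d
    rw [show q + q * τ * u = q * (1 + τ * u) by ring,
      show q + q * τ * -u = q * (1 - τ * u) by ring, negMulLog_mul, negMulLog_mul, biasEnt]
    ring
  simp only [entDensity]
  linear_combination h1 / 2 - h2 / 2

lemma integral_entDensity_update {p : (ι → Bool) → ℝ} (hp : ∀ x, 0 ≤ p x) (i : ι)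
    (d : ι → Bias) {m : Measure Bias} [IsProbabilityMeasure m] (hm : IsSymmetricLaw m) :
    ∫ u, entDensity p (toVec (update d i u)) ∂m =
      (∑ x, negMulLog (p x * lik (Finset.univ.erase i) x (toVec d)) -
        negMulLog (evidence p (Finset.univ.erase i) (toVec d))) +
      evidence p (Finset.univ.erase i) (toVec d) *
        ∫ u : Bias, (biasEnt u - biasEnt (postMean p i (toVec d) * u)) ∂m := by
  simp only [toVec_update]
  have hc : Continuous fun u : ℝ => entDensity p (update (toVec d) i u) :=
    (continuous_entDensity p).comp (continuous_const.update i continuous_id)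
  rw [hm.integral_eq hc]
  simp only [entDensity_update_symm hp i (toVec_mem d)]
  rw [integral_add (integrable_const _) (integrable_of_continuous _ (by fun_prop)),
    integral_const_mul]
  simp

/-- Increase of the conditional entropy when the observation at position `i` changes, as an
integral over the biases at the other positions. -/
lemma blockEnt_update_sub {p : (ι → Bool) → ℝ} (hp : ∀ x, 0 ≤ p x) (i : ι)
    (θ : ι → Measure Bias) [∀ j, IsProbabilityMeasure (θ j)] {m m' : Measure Bias}
    [IsProbabilityMeasure m] [IsProbabilityMeasure m'] (hm : IsSymmetricLaw m)
    (hm' : IsSymmetricLaw m') :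
    Integrable (fun d => evidence p (Finset.univ.erase i) (toVec d) *
        (∫ u : Bias, (biasEnt u - biasEnt (postMean p i (toVec d) * u)) ∂m' -
          ∫ u : Bias, (biasEnt u - biasEnt (postMean p i (toVec d) * u)) ∂m)) (Measure.pi θ) ∧
    blockEnt p (update θ i m') - blockEnt p (update θ i m) =
      ∫ d, evidence p (Finset.univ.erase i) (toVec d) *
        (∫ u : Bias, (biasEnt u - biasEnt (postMean p i (toVec d) * u)) ∂m' -
          ∫ u : Bias, (biasEnt u - biasEnt (postMean p i (toVec d) * u)) ∂m) ∂Measure.pi θ := by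
  have hc : Continuous fun d : ι → Bias => entDensity p (toVec d) := by fun_prop
  have h1 := (integrable_update θ i m hc).integral_prod_left
  have h2 := (integrable_update θ i m' hc).integral_prod_left
  have e : (fun d => evidence p (Finset.univ.erase i) (toVec d) *
        (∫ u : Bias, (biasEnt u - biasEnt (postMean p i (toVec d) * u)) ∂m' -
          ∫ u : Bias, (biasEnt u - biasEnt (postMean p i (toVec d) * u)) ∂m)) =
      fun d => ∫ u, entDensity p (toVec (update d i u)) ∂m' -
        ∫ u, entDensity p (toVec (update d i u)) ∂m := by
    ext d
    rw [integral_entDensity_update hp i d hm, integral_entDensity_update hp i d hm']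
    ring
  rw [e]
  refine ⟨h2.sub h1, ?_⟩
  rw [integral_sub h2 h1, blockEnt, blockEnt, integral_pi_update θ i m hc,
    integral_pi_update θ i m' hc]

lemma integral_biasEnt_sub {m : Measure Bias} [IsProbabilityMeasure m] (a τ : ℝ) :
    ∫ u : Bias, (a * biasEnt u - biasEnt (τ * u)) ∂m =
      a * ∫ u : Bias, biasEnt u ∂m - ∫ u : Bias, biasEnt (τ * u) ∂m := by
  rw [integral_sub (integrable_of_continuous _ (by fun_prop))
    (integrable_of_continuous _ (by fun_prop)), integral_const_mul]

/-- Applying the order to τ²B(u) - B(τu) shows that E[B(τu)] grows by at most τ² times the growth of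
E[B(u)]. The remaining factor 1 - τ², weighted by the evidence, is the error density. -/
lemma le_blockEnt_update_sub {p : (ι → Bool) → ℝ} (hp : ∀ x, 0 ≤ p x) (i : ι)
    (θ : ι → Measure Bias) [∀ j, IsProbabilityMeasure (θ j)] {m m' : Measure Bias}
    [IsProbabilityMeasure m] [IsProbabilityMeasure m'] (hm : IsSymmetricLaw m)
    (hm' : IsSymmetricLaw m') (h : LessNoisy m m') :
    blockMMSE p i θ * (∫ u : Bias, biasEnt u ∂m' - ∫ u : Bias, biasEnt u ∂m) ≤
      blockEnt p (update θ i m') - blockEnt p (update θ i m) := by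
  obtain ⟨hi, he⟩ := blockEnt_update_sub hp i θ hm hm'
  rw [he, blockMMSE, ← integral_mul_const]
  refine integral_mono
    ((integrable_of_continuous _ (continuous_errDensity_toVec hp i)).mul_const _) hi fun d => ?_
  set τ := postMean p i (toVec d) with hτ
  have hc := h _ (concaveOn_sq_mul_biasEnt_sub (postMean_mem hp i (toVec_mem d)))
    (Continuous.continuousOn (by fun_prop))
  rw [← hτ, integral_biasEnt_sub, integral_biasEnt_sub] at hc
  have e1 := integral_biasEnt_sub (m := m) 1 τ
  have e2 := integral_biasEnt_sub (m := m') 1 τ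
  simp only [one_mul] at e1 e2
  simp only [errDensity, ← hτ, e1, e2, mul_assoc]
  exact mul_le_mul_of_nonneg_left (by linarith) (evidence_nonneg hp _ (toVec_mem d))

/-- Concavity of u ↦ B(τu) makes the subtracted term grow, and the evidence has total mass one. -/
lemma blockEnt_update_sub_le {p : (ι → Bool) → ℝ} (hp : ∀ x, 0 ≤ p x) (hp1 : ∑ x, p x = 1)
    (i : ι) (θ : ι → Measure Bias) [∀ j, IsProbabilityMeasure (θ j)]
    (hθ : ∀ j, IsSymmetricLaw (θ j)) {m m' : Measure Bias}
    [IsProbabilityMeasure m] [IsProbabilityMeasure m'] (hm : IsSymmetricLaw m)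
    (hm' : IsSymmetricLaw m') (h : LessNoisy m m') :
    blockEnt p (update θ i m') - blockEnt p (update θ i m) ≤
      ∫ u : Bias, biasEnt u ∂m' - ∫ u : Bias, biasEnt u ∂m := by
  obtain ⟨hi, he⟩ := blockEnt_update_sub hp i θ hm hm'
  have : ∫ u : Bias, biasEnt u ∂m' - ∫ u : Bias, biasEnt u ∂m =
      ∫ d, evidence p (Finset.univ.erase i) (toVec d) *
        (∫ u : Bias, biasEnt u ∂m' - ∫ u : Bias, biasEnt u ∂m) ∂Measure.pi θ := by
    rw [integral_mul_const, integral_evidence hp1 _ θ hθ, one_mul]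
  rw [he, this]
  refine integral_mono hi (integrable_of_continuous _ (by fun_prop)) fun d => ?_
  have hc := h _ (concaveOn_biasEnt_mul (postMean_mem hp i (toVec_mem d)))
    (Continuous.continuousOn (by fun_prop))
  have e1 := integral_biasEnt_sub (m := m) 1 (postMean p i (toVec d))
  have e2 := integral_biasEnt_sub (m := m') 1 (postMean p i (toVec d))
  simp only [one_mul] at e1 e2
  simp only [e1, e2]
  exact mul_le_mul_of_nonneg_left (by linarith) (evidence_nonneg hp _ (toVec_mem d))

lemma measurable_postMean (p : (ι → Bool) → ℝ) (i : ι) : Measurable (postMean p i) :=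
  (continuous_corr p _ i).measurable.div (continuous_evidence p _).measurable

/-- Jensen for w ↦ B(√w) at w = τ²: the evidence-weighted mean of τ² is one minus the MMSE. -/
lemma integral_evidence_mul_biasEnt_le {p : (ι → Bool) → ℝ} (hp : ∀ x, 0 ≤ p x)
    (hp1 : ∑ x, p x = 1) (i : ι) (θ : ι → Measure Bias) [∀ j, IsProbabilityMeasure (θ j)]
    (hθ : ∀ j, IsSymmetricLaw (θ j)) :
    Integrable (fun d => evidence p (Finset.univ.erase i) (toVec d) *
      biasEnt (postMean p i (toVec d))) (Measure.pi θ) ∧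
    ∫ d, evidence p (Finset.univ.erase i) (toVec d) * biasEnt (postMean p i (toVec d))
      ∂Measure.pi θ ≤ biasEnt (√(1 - blockMMSE p i θ)) := by
  set q : (ι → Bias) → ℝ := fun d => evidence p (Finset.univ.erase i) (toVec d) with hq
  have hqc : Continuous q := by fun_prop
  have hq0 : ∀ d, 0 ≤ q d := fun d => evidence_nonneg hp _ (toVec_mem d)
  have hqi : Integrable q (Measure.pi θ) := integrable_of_continuous _ hqc
  have hτm : Measurable fun d : ι → Bias => postMean p i (toVec d) :=
    (measurable_postMean p i).comp continuous_toVec.measurable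
  have hbm : Measurable fun d : ι → Bias => biasEnt (postMean p i (toVec d)) :=
    continuous_biasEnt.measurable.comp hτm
  have hτ : ∀ d : ι → Bias, postMean p i (toVec d) ^ 2 ∈ Icc (0 : ℝ) 1 := fun d => by
    have := postMean_mem hp i (toVec_mem d)
    exact ⟨sq_nonneg _, by nlinarith [this.1, this.2]⟩
  -- Weighting by the evidence gives a probability measure, so Jensen's inequality applies to it.
  set μ := (Measure.pi θ).withDensity fun d => ENNReal.ofReal (q d) with hμ
  have hprob : IsProbabilityMeasure μ := ⟨by
    rw [hμ, withDensity_apply _ MeasurableSet.univ, Measure.restrict_univ,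
      ← ofReal_integral_eq_lintegral_ofReal hqi (ae_of_all _ hq0), hq,
      integral_evidence hp1 _ θ hθ, ENNReal.ofReal_one]⟩
  have hint : ∀ g : (ι → Bias) → ℝ, ∫ d, g d ∂μ = ∫ d, q d * g d ∂Measure.pi θ := fun g => by
    rw [hμ, integral_withDensity_eq_integral_toReal_smul (by fun_prop) (by simp)]
    simp only [ENNReal.toReal_ofReal (hq0 _), smul_eq_mul]
  refine ⟨hqi.mul_bdd (c := log 2) hbm.aestronglyMeasurable
    (ae_of_all _ fun d => abs_biasEnt_le (postMean_mem hp i (toVec_mem d))), ?_⟩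
  have hJ := concaveOn_biasEnt_sqrt.le_map_integral (μ := μ)
    (f := fun d => postMean p i (toVec d) ^ 2) (Continuous.continuousOn (by fun_prop)) isClosed_Icc
    (ae_of_all _ hτ)
    (Integrable.of_bound (hτm.pow_const 2).aestronglyMeasurable 1
      (ae_of_all _ fun d => by rw [norm_eq_abs, abs_of_nonneg (hτ d).1]; exact (hτ d).2))
    (Integrable.of_bound (C := log 2) (by
      simp only [Function.comp_def, biasEnt_sqrt_sq]; exact hbm.aestronglyMeasurable)
      (ae_of_all _ fun d => by
        simp only [Function.comp_def, biasEnt_sqrt_sq]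
        exact abs_biasEnt_le (postMean_mem hp i (toVec_mem d))))
  simp only [biasEnt_sqrt_sq] at hJ
  rw [hint, hint] at hJ
  have e : ∫ d, q d * postMean p i (toVec d) ^ 2 ∂Measure.pi θ = 1 - blockMMSE p i θ := by
    have h1 : ∫ d, q d ∂Measure.pi θ = 1 := integral_evidence hp1 _ θ hθ
    have h2 : ∀ d, q d * postMean p i (toVec d) ^ 2 = q d - errDensity p i (toVec d) := fun d => by
      simp only [errDensity, hq]
      ring
    simp only [h2]
    rw [integral_sub hqi (integrable_of_continuous _ (continuous_errDensity_toVec hp i)), h1,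
      blockMMSE]
  rwa [e] at hJ

/-- For a perfect observation u = ±1, so B(u) - B(τu) equals -log 2 - B(τ). The degraded term is
nonpositive, which leaves log 2 + B(τ) to average. -/
lemma blockEnt_update_sub_le_of_perfect {p : (ι → Bool) → ℝ} (hp : ∀ x, 0 ≤ p x)
    (hp1 : ∑ x, p x = 1) (i : ι) (θ : ι → Measure Bias) [∀ j, IsProbabilityMeasure (θ j)]
    (hθ : ∀ j, IsSymmetricLaw (θ j)) {m m' : Measure Bias}
    [IsProbabilityMeasure m] [IsProbabilityMeasure m'] (hm : IsSymmetricLaw m)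
    (hm' : IsSymmetricLaw m') (hperf : ∀ᵐ u : Bias ∂m, (u : ℝ) ^ 2 = 1) :
    blockEnt p (update θ i m') - blockEnt p (update θ i m) ≤
      log 2 + biasEnt (√(1 - blockMMSE p i θ)) := by
  obtain ⟨hi, he⟩ := blockEnt_update_sub hp i θ hm hm'
  obtain ⟨hbi, hb⟩ := integral_evidence_mul_biasEnt_le hp hp1 i θ hθ
  rw [he]
  have hqi : Integrable (fun d => evidence p (Finset.univ.erase i) (toVec d) * log 2)
    (Measure.pi θ) := integrable_of_continuous _ (by fun_prop)
  calc _ ≤ ∫ d, (evidence p (Finset.univ.erase i) (toVec d) * log 2 +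
        evidence p (Finset.univ.erase i) (toVec d) * biasEnt (postMean p i (toVec d)))
        ∂Measure.pi θ := by
        refine integral_mono hi (hqi.add hbi) fun d => ?_
        have hτ := postMean_mem hp i (toVec_mem d)
        have h1 : ∫ u : Bias, (biasEnt u - biasEnt (postMean p i (toVec d) * u)) ∂m' ≤ 0 :=
          integral_nonpos fun u => sub_nonpos.2 (biasEnt_le_biasEnt_mul hτ u.2)
        have h2 : ∫ u : Bias, (biasEnt u - biasEnt (postMean p i (toVec d) * u)) ∂m =
            -log 2 - biasEnt (postMean p i (toVec d)) := by
          rw [integral_congr_ae (g := fun _ => -log 2 - biasEnt (postMean p i (toVec d)))]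
          · simp
          · filter_upwards [hperf] with u hu
            rcases mul_self_eq_one_iff.1 (sq (u : ℝ) ▸ hu) with h | h <;> simp [h]
        rw [h2]
        simp only [← mul_add]
        exact mul_le_mul_of_nonneg_left (by linarith) (evidence_nonneg hp _ (toVec_mem d))
    _ ≤ _ := by
        rw [integral_add hqi hbi, integral_mul_const, integral_evidence hp1 _ θ hθ]
        linarith

end Block

section Block

variable {ι : Type*} [DecidableEq ι]

/-! ### Degrading all positions -/

/-- The family of laws equal to `m'` at the positions in `A` and to `m` elsewhere. -/
def hybrid (m m' : Measure Bias) (A : Finset ι) (j : ι) : Measure Bias := if j ∈ A then m' else m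

lemma hybrid_insert (m m' : Measure Bias) (A : Finset ι) (i : ι) :
    hybrid m m' (insert i A) = update (hybrid m m' A) i m' := by
  ext1 j
  by_cases h : j = i
  · subst h; simp [hybrid]
  · simp [hybrid, h]

lemma hybrid_eq_update (m m' : Measure Bias) {A : Finset ι} {i : ι} (hi : i ∉ A) :
    hybrid m m' A = update (hybrid m m' A) i m := by
  ext1 j
  by_cases h : j = i
  · subst h; simp [hybrid, hi]
  · simp [h]

lemma hybrid_empty (m m' : Measure Bias) : hybrid m m' (∅ : Finset ι) = fun _ => m := by
  ext1 j; simp [hybrid]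

lemma hybrid_univ [Fintype ι] (m m' : Measure Bias) :
    hybrid m m' (Finset.univ : Finset ι) = fun _ => m' := by
  ext1 j; simp [hybrid]

instance (m m' : Measure Bias) [IsProbabilityMeasure m] [IsProbabilityMeasure m'] (A : Finset ι)
    (j : ι) : IsProbabilityMeasure (hybrid m m' A j) := by
  unfold hybrid; split_ifs <;> infer_instance

lemma isSymmetricLaw_hybrid {m m' : Measure Bias} (hm : IsSymmetricLaw m)
    (hm' : IsSymmetricLaw m') (A : Finset ι) (j : ι) : IsSymmetricLaw (hybrid m m' A j) := by
  unfold hybrid; split_ifs <;> assumption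

variable [Fintype ι]

/-- Positions of `B` are degraded one at a time; those already in `A` need no change. -/
lemma blockMMSE_hybrid_mono {p : (ι → Bool) → ℝ} (hp : ∀ x, 0 ≤ p x) (i : ι) {m m' : Measure Bias}
    [IsProbabilityMeasure m] [IsProbabilityMeasure m'] (h : LessNoisy m m') (A B : Finset ι) :
    blockMMSE p i (hybrid m m' A) ≤ blockMMSE p i (hybrid m m' (B ∪ A)) := by
  induction B using Finset.induction_on with
  | empty => simp
  | insert j B _ ih =>
    refine ih.trans ?_
    rw [Finset.insert_union]
    by_cases hj : j ∈ B ∪ A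
    · rw [Finset.insert_eq_of_mem hj]
    · conv_lhs => rw [hybrid_eq_update m m' hj]
      rw [hybrid_insert]
      exact blockMMSE_update_mono hp i j _ h

lemma blockMMSE_const_le_hybrid {p : (ι → Bool) → ℝ} (hp : ∀ x, 0 ≤ p x) (i : ι)
    {m m' : Measure Bias} [IsProbabilityMeasure m] [IsProbabilityMeasure m'] (h : LessNoisy m m')
    (A : Finset ι) : blockMMSE p i (fun _ => m) ≤ blockMMSE p i (hybrid m m' A) := by
  simpa [hybrid_empty] using blockMMSE_hybrid_mono hp i h ∅ A

lemma blockMMSE_hybrid_le_const {p : (ι → Bool) → ℝ} (hp : ∀ x, 0 ≤ p x) (i : ι)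
    {m m' : Measure Bias} [IsProbabilityMeasure m] [IsProbabilityMeasure m'] (h : LessNoisy m m')
    (A : Finset ι) : blockMMSE p i (hybrid m m' A) ≤ blockMMSE p i (fun _ => m') := by
  have := blockMMSE_hybrid_mono hp i h A Finset.univ
  rwa [Finset.union_eq_left.2 (Finset.subset_univ A), hybrid_univ] at this

lemma blockMMSE_mono {p : (ι → Bool) → ℝ} (hp : ∀ x, 0 ≤ p x) (i : ι)
    {m m' : Measure Bias} [IsProbabilityMeasure m] [IsProbabilityMeasure m']
    (h : LessNoisy m m') : blockMMSE p i (fun _ => m) ≤ blockMMSE p i (fun _ => m') :=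
  (blockMMSE_const_le_hybrid hp i h ∅).trans (blockMMSE_hybrid_le_const hp i h ∅)

lemma LessNoisy.integral_biasEnt_le {m m' : Measure Bias} (h : LessNoisy m m') :
    ∫ u : Bias, biasEnt u ∂m ≤ ∫ u : Bias, biasEnt u ∂m' :=
  h _ concaveOn_biasEnt continuous_biasEnt.continuousOn

/-- Telescoping over hybrids. The step at position i yields the MMSE under the current hybrid, which
is at least the MMSE with all positions at the better law. -/
lemma le_blockEnt_sub {p : (ι → Bool) → ℝ} (hp : ∀ x, 0 ≤ p x) {m m' : Measure Bias}
    [IsProbabilityMeasure m] [IsProbabilityMeasure m'] (hm : IsSymmetricLaw m)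
    (hm' : IsSymmetricLaw m') (h : LessNoisy m m') :
    ∑ i, blockMMSE p i (fun _ => m) * (∫ u : Bias, biasEnt u ∂m' - ∫ u : Bias, biasEnt u ∂m) ≤
      blockEnt p (fun _ => m') - blockEnt p (fun _ => m) := by
  -- The constant families become hybrids, so the induction can run over the set of degraded
  -- positions.
  rw [← hybrid_univ m m', ← hybrid_empty m m']
  induction (Finset.univ : Finset ι) using Finset.induction_on with
  | empty => simp
  | insert i A hi ih =>
    rw [Finset.sum_insert hi]
    have h1 := le_blockEnt_update_sub hp i (hybrid m m' A) hm hm' h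
    rw [← hybrid_insert, ← hybrid_eq_update m m' hi] at h1
    have h2 := mul_le_mul_of_nonneg_right (blockMMSE_const_le_hybrid hp i h A)
      (sub_nonneg.2 h.integral_biasEnt_le)
    rw [hybrid_empty] at ih ⊢
    linarith

lemma blockEnt_sub_le {p : (ι → Bool) → ℝ} (hp : ∀ x, 0 ≤ p x) (hp1 : ∑ x, p x = 1)
    {m m' : Measure Bias} [IsProbabilityMeasure m] [IsProbabilityMeasure m']
    (hm : IsSymmetricLaw m) (hm' : IsSymmetricLaw m') (h : LessNoisy m m') :
    blockEnt p (fun _ => m') - blockEnt p (fun _ => m) ≤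
      ∑ _i : ι, (∫ u : Bias, biasEnt u ∂m' - ∫ u : Bias, biasEnt u ∂m) := by
  rw [← hybrid_univ m m', ← hybrid_empty m m']
  induction (Finset.univ : Finset ι) using Finset.induction_on with
  | empty => simp
  | insert i A hi ih =>
    rw [Finset.sum_insert hi]
    have h1 := blockEnt_update_sub_le hp hp1 i (hybrid m m' A) (isSymmetricLaw_hybrid hm hm' A)
      hm hm' h
    rw [← hybrid_insert, ← hybrid_eq_update m m' hi] at h1
    linarith

lemma blockEnt_sub_le_of_perfect {p : (ι → Bool) → ℝ} (hp : ∀ x, 0 ≤ p x) (hp1 : ∑ x, p x = 1)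
    {m m' : Measure Bias} [IsProbabilityMeasure m] [IsProbabilityMeasure m']
    (hm : IsSymmetricLaw m) (hm' : IsSymmetricLaw m') (h : LessNoisy m m')
    (hperf : ∀ᵐ u : Bias ∂m, (u : ℝ) ^ 2 = 1) :
    blockEnt p (fun _ => m') - blockEnt p (fun _ => m) ≤
      ∑ i : ι, (log 2 + biasEnt (√(1 - blockMMSE p i (fun _ => m')))) := by
  rw [← hybrid_univ m m', ← hybrid_empty m m']
  -- The MMSE on the right is fixed at the fully degraded family before the induction, so that only
  -- the range of summation varies.
  conv_rhs => rw [hybrid_univ]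
  induction (Finset.univ : Finset ι) using Finset.induction_on with
  | empty => simp
  | insert i A hi ih =>
    rw [Finset.sum_insert hi]
    have hs := isSymmetricLaw_hybrid hm hm' A
    have h1 := blockEnt_update_sub_le_of_perfect hp hp1 i (hybrid m m' A) hs hm hm' hperf
    rw [← hybrid_insert, ← hybrid_eq_update m m' hi] at h1
    have hmem : ∀ v : ℝ, 0 ≤ v → √(1 - v) ∈ Icc (0 : ℝ) 1 := fun v hv =>
      ⟨sqrt_nonneg _, by rw [sqrt_le_one]; linarith⟩
    -- The bound is increasing in the MMSE, and no hybrid has a larger MMSE than the fully degraded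
    -- family.
    have h2 := antitoneOn_biasEnt (hmem _ (blockMMSE_nonneg hp i _))
      (hmem _ (blockMMSE_nonneg hp i _))
      (sqrt_le_sqrt (sub_le_sub_left (blockMMSE_hybrid_le_const hp i h A) 1))
    linarith

lemma ae_pi_const {ι : Type*} [Fintype ι] {m : Measure Bias} [IsProbabilityMeasure m] {P : Bias → Prop}
    (h : ∀ᵐ u ∂m, P u) : ∀ᵐ d ∂Measure.pi (fun _ : ι => m), ∀ j, P (d j) :=
  ae_all_iff.2 fun j => (Measure.quasiMeasurePreserving_eval (fun _ : ι => m) j).ae h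

/-- Biases ±1 spell out one word; all other words have likelihood zero, and the two terms of the
entropy density coincide. -/
lemma blockEnt_of_perfect (p : (ι → Bool) → ℝ) {m : Measure Bias} [IsProbabilityMeasure m]
    (hperf : ∀ᵐ u : Bias ∂m, (u : ℝ) ^ 2 = 1) : blockEnt p (fun _ => m) = 0 := by
  refine integral_eq_zero_of_ae ?_
  filter_upwards [ae_pi_const (ι := ι) hperf] with d hd
  have hd' : ∀ j, ∃ b, (d j : ℝ) = bpsk b := fun j => by
    rcases mul_self_eq_one_iff.1 (sq (d j : ℝ) ▸ hd j) with h | h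
    · exact ⟨false, by simp [h, bpsk]⟩
    · exact ⟨true, by simp [h, bpsk]⟩
  choose y hy using hd'
  have hl : ∀ x, x ≠ y → lik Finset.univ x (toVec d) = 0 := fun x hx => by
    obtain ⟨j, hj⟩ := Function.ne_iff.1 hx
    refine Finset.prod_eq_zero (Finset.mem_univ j) ?_
    rw [toVec, hy]
    revert hj
    cases x j <;> cases y j <;> simp [bpsk]
  simp only [entDensity, evidence, Pi.zero_apply]
  rw [Fintype.sum_eq_single y fun x hx => by simp [hl x hx],
    Fintype.sum_eq_single y fun x hx => by simp [hl x hx], sub_self]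

lemma blockEnt_of_uninformative {p : (ι → Bool) → ℝ} (hp1 : ∑ x, p x = 1) {m : Measure Bias}
    [IsProbabilityMeasure m] (h0 : ∀ᵐ u : Bias ∂m, (u : ℝ) = 0) :
    blockEnt p (fun _ => m) = ∑ x, negMulLog (p x) := by
  rw [blockEnt, integral_congr_ae (g := fun _ => ∑ x, negMulLog (p x))]
  · simp
  · filter_upwards [ae_pi_const (ι := ι) h0] with d hd
    have hl : ∀ x, lik Finset.univ x (toVec d) = 1 := fun x =>
      Finset.prod_eq_one fun j _ => by simp [toVec, hd j]
    simp [entDensity, evidence, hl, hp1]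

/-! ### Symmetry -/

lemma lik_comp_perm (σ : Equiv.Perm ι) (i : ι) (x : ι → Bool) (d : ι → ℝ) :
    lik (Finset.univ.erase i) (fun k => x (σ k)) (fun k => d (σ k)) =
      lik (Finset.univ.erase (σ i)) x d :=
  Finset.prod_equiv σ (by simp) fun _ _ => rfl

lemma sum_comp_perm (σ : Equiv.Perm ι) (f : (ι → Bool) → ℝ) :
    ∑ x : ι → Bool, f (fun k => x (σ k)) = ∑ x, f x :=
  Equiv.sum_comp (Equiv.arrowCongr σ.symm (Equiv.refl Bool)) f

lemma errDensity_comp_perm {p : (ι → Bool) → ℝ} (σ : Equiv.Perm ι)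
    (hσ : ∀ x : ι → Bool, p (fun k => x (σ k)) = p x) (i : ι) (d : ι → ℝ) :
    errDensity p i (fun k => d (σ k)) = errDensity p (σ i) d := by
  have h1 : evidence p (Finset.univ.erase i) (fun k => d (σ k)) =
      evidence p (Finset.univ.erase (σ i)) d := by
    rw [evidence, ← sum_comp_perm σ]
    simp only [hσ, lik_comp_perm, evidence]
  have h2 : corr p (Finset.univ.erase i) i (fun k => d (σ k)) =
      corr p (Finset.univ.erase (σ i)) (σ i) d := by
    rw [corr, ← sum_comp_perm σ]
    simp only [hσ, lik_comp_perm, corr]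
  rw [errDensity_eq, errDensity_eq, h1, h2]

/-- Relabelling the positions preserves both the prior and the product of identical bias laws. -/
lemma blockMMSE_perm {p : (ι → Bool) → ℝ} (σ : Equiv.Perm ι)
    (hσ : ∀ x : ι → Bool, p (fun k => x (σ k)) = p x) (i : ι) (m : Measure Bias)
    [IsProbabilityMeasure m] : blockMMSE p (σ i) (fun _ => m) = blockMMSE p i (fun _ => m) := by
  have h := measurePreserving_piCongrLeft (fun _ : ι => m) σ.symm
  symm
  rw [blockMMSE, blockMMSE, ← h.integral_comp']
  congr 1 with d
  rw [← errDensity_comp_perm σ hσ]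
  congr 1 with k
  have := Equiv.piCongrLeft_apply_apply (fun _ : ι => Bias) σ.symm d (σ k)
  rw [Equiv.symm_apply_apply] at this
  simp only [toVec, MeasurableEquiv.coe_piCongrLeft, this]

end Block

/-! ### Conditional expectations from likelihoods -/

/-- `l a y` is the joint density, with respect to `ρ` in the second variable, of the pair `(X, Y)`
with `X` discrete. -/
structure IsLikelihood {Ω A E : Type*} [MeasurableSpace Ω] [Fintype A] [MeasurableSpace A]
    [MeasurableSpace E] (P : Measure Ω) (X : Ω → A) (Y : Ω → E) (ρ : Measure E)
    (l : A → E → ℝ) : Prop where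
  measurable_fst : Measurable X
  measurable_snd : Measurable Y
  measurable : ∀ a, Measurable (l a)
  nonneg : ∀ a y, 0 ≤ l a y
  bdd : ∃ c, ∀ a y, |l a y| ≤ c
  integral_eq : ∀ g : A → E → ℝ, (∀ a, Measurable (g a)) → (∃ c, ∀ a y, |g a y| ≤ c) →
    ∫ ω, g (X ω) (Y ω) ∂P = ∑ a, ∫ y, g a y * l a y ∂ρ

lemma integrable_of_bdd {E : Type*} [MeasurableSpace E] {ρ : Measure E} [IsFiniteMeasure ρ]
    {f : E → ℝ} (hf : Measurable f) {c : ℝ} (hc : ∀ y, |f y| ≤ c) : Integrable f ρ :=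
  Integrable.of_bound hf.aestronglyMeasurable c (ae_of_all _ hc)

namespace IsLikelihood

variable {Ω A E : Type*} [Fintype A]

/-- The conditional mean of `φ X` as a function of the observation. -/
noncomputable def estimator (l : A → E → ℝ) (φ : A → ℝ) (y : E) : ℝ :=
  (∑ a, φ a * l a y) / ∑ a, l a y

lemma estimator_mul {l : A → E → ℝ} (hl : ∀ a y, 0 ≤ l a y) (φ : A → ℝ) (y : E) :
    estimator l φ y * ∑ a, l a y = ∑ a, φ a * l a y := by
  by_cases h0 : ∑ a, l a y = 0
  · have : ∀ a, l a y = 0 := fun a =>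
      (Finset.sum_eq_zero_iff_of_nonneg fun a _ => hl a y).1 h0 a (Finset.mem_univ a)
    simp [this]
  · rw [estimator, div_mul_cancel₀ _ h0]

lemma abs_estimator_le {l : A → E → ℝ} (hl : ∀ a y, 0 ≤ l a y) (φ : A → ℝ) (y : E) :
    |estimator l φ y| ≤ ∑ a, |φ a| := by
  have hq : 0 ≤ ∑ a, l a y := Finset.sum_nonneg fun a _ => hl a y
  rw [estimator, abs_div, abs_of_nonneg hq]
  refine div_le_of_le_mul₀ hq (Finset.sum_nonneg fun a _ => abs_nonneg _) ?_
  refine (Finset.abs_sum_le_sum_abs _ _).trans ?_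
  rw [Finset.mul_sum]
  refine Finset.sum_le_sum fun a _ => ?_
  rw [abs_mul, abs_of_nonneg (hl a y)]
  exact mul_le_mul_of_nonneg_right
    (Finset.single_le_sum (f := fun a => |φ a|) (fun a _ => abs_nonneg _) (Finset.mem_univ a))
    (hl a y)

variable [MeasurableSpace Ω] [MeasurableSpace A] [mE : MeasurableSpace E] {P : Measure Ω}
  {X : Ω → A} {Y : Ω → E} {ρ : Measure E} {l : A → E → ℝ}

lemma measurable_estimator (h : IsLikelihood P X Y ρ l) (φ : A → ℝ) :
    Measurable (estimator l φ) :=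
  (Finset.measurable_fun_sum _ fun a _ => (h.measurable a).const_mul _).div
    (Finset.measurable_fun_sum _ fun a _ => h.measurable a)

variable [IsFiniteMeasure ρ]

lemma integral_eq_sum (h : IsLikelihood P X Y ρ l) {g : A → E → ℝ} (hg : ∀ a, Measurable (g a))
    {c : ℝ} (hc : ∀ a y, |g a y| ≤ c) :
    ∫ ω, g (X ω) (Y ω) ∂P = ∫ y, ∑ a, g a y * l a y ∂ρ := by
  obtain ⟨c', hc'⟩ := h.bdd
  rw [h.integral_eq g hg ⟨c, hc⟩, integral_finsetSum]
  intro a _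
  refine integrable_of_bdd ((hg a).mul (h.measurable a)) (c := c * c') fun y => ?_
  rw [abs_mul]
  exact mul_le_mul (hc a y) (hc' a y) (abs_nonneg _) ((abs_nonneg _).trans (hc a y))

variable [MeasurableSingletonClass A] [IsProbabilityMeasure P]

/-- Bayes' rule, tested on events `Y ⁻¹' B`. Where the total density is zero, every `l a` is zero by
nonnegativity, so the value of the quotient there is immaterial. -/
lemma condExp_eq (h : IsLikelihood P X Y ρ l) (φ : A → ℝ) :
    P[fun ω => φ (X ω) | mE.comap Y] =ᵐ[P] fun ω => estimator l φ (Y ω) := by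
  have hb : ∀ a, |φ a| ≤ ∑ a, |φ a| := fun a =>
    Finset.single_le_sum (f := fun a => |φ a|) (fun a _ => abs_nonneg _) (Finset.mem_univ a)
  have hTm := h.measurable_estimator φ
  have hT : Integrable (fun ω => estimator l φ (Y ω)) P :=
    integrable_of_bdd (hTm.comp h.measurable_snd) fun ω => abs_estimator_le h.nonneg φ (Y ω)
  have hφ : Measurable fun ω => φ (X ω) := (measurable_of_finite φ).comp h.measurable_fst
  symm
  refine ae_eq_condExp_of_forall_setIntegral_eq h.measurable_snd.comap_le
    (integrable_of_bdd hφ fun ω => hb (X ω)) (fun s _ _ => hT.integrableOn) ?_ ?_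
  · rintro s ⟨B, hB, rfl⟩ -
    have hs := h.measurable_snd hB
    rw [← integral_indicator hs, ← integral_indicator hs]
    have e1 := h.integral_eq_sum (g := fun _ => B.indicator (estimator l φ))
      (fun _ => hTm.indicator hB) (c := ∑ a, |φ a|) fun _ y => by
        by_cases hy : y ∈ B
        · simpa [hy] using abs_estimator_le h.nonneg φ y
        · simpa [hy] using Finset.sum_nonneg fun a _ => abs_nonneg (φ a)
    have e2 := h.integral_eq_sum (g := fun a => B.indicator fun _ => φ a)
      (fun _ => measurable_const.indicator hB) (c := ∑ a, |φ a|) fun a y => by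
        by_cases hy : y ∈ B
        · simpa [hy] using hb a
        · simpa [hy] using Finset.sum_nonneg fun a _ => abs_nonneg (φ a)
    have e3 : ∀ y, ∑ a, B.indicator (estimator l φ) y * l a y =
        ∑ a, B.indicator (fun _ => φ a) y * l a y := fun y => by
      by_cases hy : y ∈ B
      · simp only [hy, indicator_of_mem, ← Finset.mul_sum, estimator_mul h.nonneg]
      · simp [hy]
    simp only [e3] at e1
    exact e1.trans e2.symm
  · exact (hTm.comp (comap_measurable Y)).aestronglyMeasurable

/-- Expanding the square, the cross term is evaluated by the defining identity of the estimator, and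
φ² = 1 leaves one minus the squared estimate. -/
lemma mmse_eq (h : IsLikelihood P X Y ρ l) {φ : A → ℝ} (hφ : ∀ a, φ a ^ 2 = 1) :
    mmse P (fun ω => φ (X ω)) Y =
      ∫ y, (∑ a, l a y) * (1 - estimator l φ y ^ 2) ∂ρ := by
  have hb : ∀ a, |φ a| ≤ ∑ a, |φ a| := fun a =>
    Finset.single_le_sum (f := fun a => |φ a|) (fun a _ => abs_nonneg _) (Finset.mem_univ a)
  rw [mmse]
  have e : (fun ω => (φ (X ω) - (P[fun ω => φ (X ω) | mE.comap Y]) ω) ^ 2) =ᵐ[P]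
      fun ω => (φ (X ω) - estimator l φ (Y ω)) ^ 2 := by
    filter_upwards [h.condExp_eq φ] with ω hω
    rw [hω]
  rw [integral_congr_ae e, h.integral_eq_sum (g := fun a y => (φ a - estimator l φ y) ^ 2)
    (fun a => ((h.measurable_estimator φ).const_sub _).pow_const 2)
    (c := ((∑ a, |φ a|) + ∑ a, |φ a|) ^ 2)]
  · congr 1 with y
    have e1 : ∀ a, (φ a - estimator l φ y) ^ 2 * l a y =
        l a y - 2 * estimator l φ y * (φ a * l a y) + estimator l φ y ^ 2 * l a y := fun a => by
      linear_combination l a y * hφ a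
    simp only [e1, Finset.sum_add_distrib, Finset.sum_sub_distrib, ← Finset.mul_sum]
    linear_combination 2 * estimator l φ y * estimator_mul h.nonneg φ y
  · intro a y
    rw [abs_pow]
    refine pow_le_pow_left₀ (abs_nonneg _) ((abs_sub _ _).trans ?_) 2
    exact add_le_add (hb a) (abs_estimator_le h.nonneg φ y)

/-- The chain rule in density form: with q the total density, q · negMulLog (l/q) = negMulLog l - l
· negMulLog q / q, summed over the alphabet. -/
lemma condEntropy_eq (h : IsLikelihood P X Y ρ l) :
    condEntropy P X Y =
      (∫ y, (∑ a, negMulLog (l a y) - negMulLog (∑ a, l a y)) ∂ρ) / log 2 := by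
  classical
  rw [condEntropy]
  congr 1
  -- Indicators of single letters: their estimators are the posterior probabilities.
  set φ : A → A → ℝ := fun a b => if b = a then 1 else 0 with hφ
  have hsum : ∀ a y, ∑ b, φ a b * l b y = l a y := fun a y => by simp [hφ]
  have hφs : ∀ a, ∑ b, |φ a b| = 1 := fun a => by
    rw [Fintype.sum_eq_single a fun b hb => by simp [hφ, hb]]; simp [hφ]
  have hest : ∀ a y, estimator l (φ a) y = l a y / ∑ b, l b y := fun a y => by
    rw [estimator, hsum]
  have hcond : ∀ a, (P⟦X ⁻¹' {a} | mE.comap Y⟧) =ᵐ[P] fun ω => estimator l (φ a) (Y ω) := by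
    intro a
    have : (X ⁻¹' {a}).indicator (fun _ => (1 : ℝ)) = fun ω => φ a (X ω) := by
      ext ω
      by_cases hω : X ω = a <;> simp [hφ, hω]
    rw [this]
    exact h.condExp_eq (φ a)
  have e : (fun ω => ∑ a, negMulLog ((P⟦X ⁻¹' {a} | mE.comap Y⟧) ω)) =ᵐ[P]
      fun ω => ∑ a, negMulLog (estimator l (φ a) (Y ω)) := by
    filter_upwards [ae_all_iff.2 hcond] with ω hω
    simp only [hω]
  have h01 : ∀ a y, estimator l (φ a) y ∈ Icc (0 : ℝ) 1 := fun a y => by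
    refine ⟨?_, ?_⟩
    · rw [hest]
      exact div_nonneg (h.nonneg a y) (Finset.sum_nonneg fun b _ => h.nonneg b y)
    · exact (le_abs_self _).trans ((abs_estimator_le h.nonneg (φ a) y).trans (hφs a).le)
  rw [integral_congr_ae e, h.integral_eq_sum
    (g := fun _ y => ∑ a, negMulLog (estimator l (φ a) y))
    (fun _ => Finset.measurable_fun_sum _ fun a _ =>
      continuous_negMulLog.measurable.comp (h.measurable_estimator (φ a)))
    (c := ∑ _a : A, (1 : ℝ))]
  · congr 1 with y
    rw [← Finset.mul_sum, Finset.sum_mul]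
    set q := ∑ b, l b y with hq
    by_cases h0 : q = 0
    · have : ∀ a, l a y = 0 := fun a =>
        (Finset.sum_eq_zero_iff_of_nonneg fun a _ => h.nonneg a y).1 h0 a (Finset.mem_univ a)
      simp [this, h0]
    · have e1 : ∀ a, negMulLog (estimator l (φ a) y) * q =
          negMulLog (l a y) - l a y * (negMulLog q / q) := fun a => by
        have : l a y = q * estimator l (φ a) y := by
          rw [mul_comm, estimator_mul h.nonneg, hsum]
        rw [this, negMulLog_mul]
        field_simp
        ring
      simp only [e1, Finset.sum_sub_distrib, ← Finset.sum_mul, ← hq]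
      field_simp
  · intro _ y
    refine (Finset.abs_sum_le_sum_abs _ _).trans (Finset.sum_le_sum fun a _ => ?_)
    obtain ⟨h0, h1⟩ := h01 a y
    rw [abs_of_nonneg (negMulLog_nonneg h0 h1)]
    have := negMulLog_le_one_sub_self h0
    linarith

end IsLikelihood

/-- Likelihood of a discrete input `x` with law `μ` observed through `F x z` with independent
noise `z` of law `κ`. -/
lemma isLikelihood_prod {A B E : Type*} [Fintype A] [MeasurableSpace A]
    [MeasurableSingletonClass A] [MeasurableSpace B] [MeasurableSpace E] (μ : Measure A)
    [IsProbabilityMeasure μ] (κ : Measure B) [IsProbabilityMeasure κ] (ρ : Measure E)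
    {F : A → B → E} (hF : ∀ a, Measurable (F a)) {l : A → E → ℝ} (hl : ∀ a, Measurable (l a))
    (hl0 : ∀ a y, 0 ≤ l a y) (hlb : ∃ c, ∀ a y, |l a y| ≤ c)
    (hκ : ∀ a, κ.map (F a) = ρ.withDensity fun y => ENNReal.ofReal (l a y)) :
    IsLikelihood (μ.prod κ) (fun ω => ω.1) (fun ω => F ω.1 ω.2) ρ
      (fun a y => μ.real {a} * l a y) where
  measurable_fst := measurable_fst
  measurable_snd := measurable_from_prod_countable_right fun a => hF a
  measurable a := (hl a).const_mul _
  nonneg a y := mul_nonneg measureReal_nonneg (hl0 a y)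
  bdd := by
    obtain ⟨c, hc⟩ := hlb
    refine ⟨c, fun a y => ?_⟩
    rw [abs_mul, abs_of_nonneg measureReal_nonneg]
    have h1 : μ.real {a} ≤ 1 := measureReal_le_one
    have := abs_nonneg (l a y)
    nlinarith [hc a y]
  integral_eq g hg := by
    rintro ⟨c, hc⟩
    have hm : Measurable fun ω : A × B => g ω.1 (F ω.1 ω.2) :=
      measurable_from_prod_countable_right fun a => (hg a).comp (hF a)
    rw [integral_prod _ (integrable_of_bdd hm fun ω => hc _ _), integral_fintype
      (Integrable.of_finite)]
    refine Finset.sum_congr rfl fun a _ => ?_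
    simp only [smul_eq_mul]
    rw [← integral_map (φ := F a) (f := g a) (hF a).aemeasurable (hg a).aestronglyMeasurable, hκ,
      integral_withDensity_eq_integral_toReal_smul (by have := hl a; fun_prop) (by simp),
      ← integral_const_mul]
    congr 1 with y
    rw [ENNReal.toReal_ofReal (hl0 a y), smul_eq_mul]
    ring

/-! ### Bias of a channel output -/

lemma output_false : output false = id := by
  ext z; simp [output, bpsk]

lemma output_true : output true = fun z => -z := by
  ext z; simp [output, bpsk]

@[fun_prop]
lemma measurable_output (b : Bool) : Measurable (output b) := by
  cases b
  · rw [output_false]; exact measurable_id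
  · rw [output_true]; exact continuous_neg.measurable

instance (ν : Measure EReal) [IsProbabilityMeasure ν] (b : Bool) :
    IsProbabilityMeasure (transition ν b) :=
  Measure.isProbabilityMeasure_map (measurable_output b).aemeasurable

lemma map_neg_transition (ν : Measure EReal) (b : Bool) :
    (transition ν b).map (fun y => -y) = transition ν (!b) := by
  have hn : Measurable fun y : EReal => -y := continuous_neg.measurable
  rw [transition, transition, Measure.map_map hn (measurable_output b)]
  congr 1
  ext y
  cases b <;> simp [output_false, output_true]

/-- Law of the channel output for a uniform input. -/
noncomputable def outLaw (ν : Measure EReal) : Measure EReal :=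
  (2 : ENNReal)⁻¹ • (transition ν false + transition ν true)

lemma two_smul_outLaw (ν : Measure EReal) :
    (2 : ENNReal) • outLaw ν = transition ν false + transition ν true := by
  rw [outLaw, smul_smul, ENNReal.mul_inv_cancel (by simp) (by simp), one_smul]

instance (ν : Measure EReal) [IsProbabilityMeasure ν] : IsProbabilityMeasure (outLaw ν) := ⟨by
  simp only [outLaw, Measure.smul_apply, Measure.add_apply, measure_univ, smul_eq_mul]
  rw [one_add_one_eq_two, ENNReal.inv_mul_cancel (by simp) (by simp)]⟩

lemma map_neg_outLaw (ν : Measure EReal) : (outLaw ν).map (fun y => -y) = outLaw ν := by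
  have hn : Measurable fun y : EReal => -y := continuous_neg.measurable
  rw [outLaw, Measure.map_smul, Measure.map_add _ _ hn, map_neg_transition, map_neg_transition,
    add_comm]
  rfl

/-- Posterior mean of a uniform input given the channel output. -/
noncomputable def bias (ν : Measure EReal) (y : EReal) : Bias :=
  projIcc (-1) 1 (by norm_num) (((transition ν false).rnDeriv (outLaw ν) y).toReal - 1)

@[fun_prop]
lemma measurable_bias (ν : Measure EReal) : Measurable (bias ν) :=
  continuous_projIcc.measurable.comp ((Measure.measurable_rnDeriv _ _).ennreal_toReal.sub_const 1)

/-- The output law of a uniform input is half the sum of the two transitions, so this Radon-Nikodym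
derivative lies in [0,2] almost everywhere. The clamping in `bias` thus changes only a null set, and
makes the bounds hold everywhere. -/
lemma transition_false_eq (ν : Measure EReal) [IsProbabilityMeasure ν] :
    transition ν false = (outLaw ν).withDensity fun y => ENNReal.ofReal (1 + bias ν y) := by
  have hle : transition ν false ≤ (2 : ENNReal) • outLaw ν := by
    rw [two_smul_outLaw]; exact Measure.le_add_right le_rfl
  have hac : transition ν false ≪ outLaw ν :=
    (Measure.absolutelyContinuous_of_le hle).trans Measure.smul_absolutelyContinuous
  have h2 : ∀ᵐ y ∂outLaw ν, (transition ν false).rnDeriv (outLaw ν) y ≤ 2 := by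
    refine ae_le_of_forall_setLIntegral_le_of_sigmaFinite (Measure.measurable_rnDeriv _ _)
      fun s hs _ => ?_
    rw [setLIntegral_const, Measure.setLIntegral_rnDeriv hac]
    exact hle s
  conv_lhs => rw [← Measure.withDensity_rnDeriv_eq _ _ hac]
  refine withDensity_congr_ae ?_
  filter_upwards [h2] with y hy
  have hr : ((transition ν false).rnDeriv (outLaw ν) y).toReal - 1 ∈ Icc (-1 : ℝ) 1 := by
    have h3 := ENNReal.toReal_mono (by simp) hy
    have h4 := ENNReal.toReal_nonneg (a := (transition ν false).rnDeriv (outLaw ν) y)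
    simp only [ENNReal.toReal_ofNat] at h3
    exact ⟨by linarith, by linarith⟩
  rw [bias, projIcc_of_mem _ hr]
  simp only [add_sub_cancel]
  rw [ENNReal.ofReal_toReal (ne_top_of_le_ne_top (by simp) hy)]

/-- Given the code symbol `b`, the output has density `1 + (-1)^b D` with respect to the output law
for a uniform input, where `D` is the posterior mean. -/
lemma transition_eq (ν : Measure EReal) [IsProbabilityMeasure ν] (b : Bool) :
    transition ν b =
      (outLaw ν).withDensity fun y => ENNReal.ofReal (1 + bpsk b * bias ν y) := by
  cases b
  · simpa [bpsk] using transition_false_eq ν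
  · have h1 : transition ν false + transition ν true = transition ν false +
        (outLaw ν).withDensity fun y => ENNReal.ofReal (1 + bpsk true * bias ν y) := by
      conv_rhs => rw [transition_false_eq ν]
      rw [← two_smul_outLaw, ← withDensity_add_left (by fun_prop), ← withDensity_const]
      congr 1 with y
      rw [Pi.add_apply, ← ENNReal.ofReal_add (by linarith [(bias ν y).2.1])
        (one_add_bpsk_mul_nonneg true (bias ν y).2)]
      simp only [bpsk, if_true]
      ring_nf
      simp
    ext s hs
    have := congrArg (fun m : Measure EReal => m s) h1
    simp only [Measure.add_apply] at this
    exact (ENNReal.add_right_inj (measure_ne_top _ _)).1 this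

/-- Negating the output exchanges the two transitions and preserves the output law, so the densities
1 + D(-y) and 1 - D(y) agree almost everywhere. -/
lemma bias_neg (ν : Measure EReal) [IsProbabilityMeasure ν] :
    ∀ᵐ y ∂outLaw ν, (bias ν (-y) : ℝ) = -bias ν y := by
  have hn : Measurable fun y : EReal => -y := continuous_neg.measurable
  have h : (outLaw ν).withDensity (fun y => ENNReal.ofReal (1 + bias ν (-y))) =
      (outLaw ν).withDensity fun y => ENNReal.ofReal (1 + bpsk true * bias ν y) := by
    rw [← transition_eq, ← Bool.not_false, ← map_neg_transition]
    ext s hs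
    rw [withDensity_apply _ hs, Measure.map_apply hn hs, transition_false_eq,
      withDensity_apply _ (hn hs)]
    conv_lhs => rw [← map_neg_outLaw ν]
    rw [setLIntegral_map hs (by fun_prop) hn]
    simp
  have hfin : ∫⁻ y, ENNReal.ofReal (1 + bias ν (-y)) ∂outLaw ν ≠ ⊤ := by
    rw [← setLIntegral_univ, ← withDensity_apply _ MeasurableSet.univ, h, ← transition_eq]
    simp
  have h' := (withDensity_eq_iff (by fun_prop) (by fun_prop) hfin).1 h
  filter_upwards [h'] with y hy
  rw [ENNReal.ofReal_eq_ofReal_iff (by linarith [(bias ν (-y)).2.1])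
    (one_add_bpsk_mul_nonneg true (bias ν y).2)] at hy
  simp only [bpsk, if_true] at hy
  linarith

/-- Law of the posterior mean of a uniform input given the channel output. -/
noncomputable def biasLaw (ν : Measure EReal) : Measure Bias := (outLaw ν).map (bias ν)

instance (ν : Measure EReal) [IsProbabilityMeasure ν] : IsProbabilityMeasure (biasLaw ν) :=
  Measure.isProbabilityMeasure_map (measurable_bias ν).aemeasurable

lemma integral_biasLaw (ν : Measure EReal) {f : Bias → ℝ} (hf : Continuous f) :
    ∫ d, f d ∂biasLaw ν = ∫ y, f (bias ν y) ∂outLaw ν :=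
  integral_map (measurable_bias ν).aemeasurable hf.aestronglyMeasurable

lemma isSymmetricLaw_biasLaw (ν : Measure EReal) [IsProbabilityMeasure ν] :
    IsSymmetricLaw (biasLaw ν) := by
  intro f hf
  have hn : Measurable fun y : EReal => -y := continuous_neg.measurable
  rw [integral_biasLaw ν (f := fun d => f (-d)) (by fun_prop),
    integral_biasLaw ν (f := fun d => f d) (by fun_prop)]
  conv_rhs => rw [← map_neg_outLaw ν]
  rw [integral_map hn.aemeasurable]
  · refine integral_congr_ae ?_
    filter_upwards [bias_neg ν] with y hy
    rw [hy]
  · exact (hf.measurable.comp (by fun_prop)).aestronglyMeasurable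

/-! ### Degradation -/

lemma outLaw_bind {ν ν' : Measure EReal} {K : Kernel EReal EReal}
    (hK : ∀ b, transition ν' b = (transition ν b).bind K) : outLaw ν' = (outLaw ν).bind K := by
  ext s hs
  rw [Measure.bind_apply hs K.measurable.aemeasurable, outLaw, outLaw, lintegral_smul_measure,
    lintegral_add_measure, hK, hK]
  simp only [Measure.smul_apply, Measure.add_apply,
    Measure.bind_apply hs K.measurable.aemeasurable]

lemma integral_mul_bias (ν : Measure EReal) [IsProbabilityMeasure ν] {g : EReal → ℝ}
    (hg : Measurable g) (hg1 : ∀ y, |g y| ≤ 1) :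
    ∫ y, g y * bias ν y ∂outLaw ν = ∫ y, g y ∂transition ν false - ∫ y, g y ∂outLaw ν := by
  rw [transition_false_eq, integral_withDensity_eq_integral_toReal_smul (by fun_prop) (by simp),
    ← integral_sub]
  · congr 1 with y
    rw [ENNReal.toReal_ofReal (by linarith [(bias ν y).2.1]), smul_eq_mul]
    ring
  · refine integrable_of_bdd (by fun_prop) (c := 2) fun y => ?_
    have hb := (bias ν y).2
    rw [ENNReal.toReal_ofReal (by linarith [hb.1]), smul_eq_mul, abs_mul,
      abs_of_nonneg (by linarith [hb.1] : 0 ≤ 1 + (bias ν y : ℝ))]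
    nlinarith [hg1 y, abs_nonneg (g y), hb.1, hb.2]
  · exact integrable_of_bdd hg hg1

lemma integral_kernel_real (μ : Measure EReal) [IsFiniteMeasure μ] (K : Kernel EReal EReal)
    [IsMarkovKernel K] {B : Set EReal} (hB : MeasurableSet B) :
    ∫ y, (K y).real B ∂μ = (μ.bind K).real B := by
  rw [measureReal_def, Measure.bind_apply hB K.measurable.aemeasurable]
  exact integral_toReal (K.measurable_coe hB).aemeasurable (ae_of_all _ fun y => measure_lt_top _ _)

/-- The posterior mean given a degraded output is the conditional expectation of the posterior mean
given the original output. -/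
lemma condExp_bias {ν ν' : Measure EReal} [IsProbabilityMeasure ν] [IsProbabilityMeasure ν']
    {K : Kernel EReal EReal} [IsMarkovKernel K]
    (hK : ∀ b, transition ν' b = (transition ν b).bind K) :
    (fun q : EReal × EReal => (bias ν' q.2 : ℝ)) =ᵐ[outLaw ν ⊗ₘ K]
      (outLaw ν ⊗ₘ K)[fun q => (bias ν q.1 : ℝ) |
        MeasurableSpace.comap Prod.snd (inferInstance : MeasurableSpace EReal)] := by
  have hXi : Integrable (fun q : EReal × EReal => (bias ν q.1 : ℝ)) (outLaw ν ⊗ₘ K) :=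
    integrable_of_bdd (by fun_prop) fun q => abs_le.2 (bias ν q.1).2
  have hYi : Integrable (fun q : EReal × EReal => (bias ν' q.2 : ℝ)) (outLaw ν ⊗ₘ K) :=
    integrable_of_bdd (by fun_prop) fun q => abs_le.2 (bias ν' q.2).2
  refine ae_eq_condExp_of_forall_setIntegral_eq measurable_snd.comap_le hXi
    (fun _ _ _ => hYi.integrableOn) ?_ ?_
  · rintro s ⟨B, hB, rfl⟩ -
    have hs : MeasurableSet (Prod.snd ⁻¹' B : Set (EReal × EReal)) := measurable_snd hB
    have hbd : ∀ y, |B.indicator (1 : EReal → ℝ) y| ≤ 1 := fun y => by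
      by_cases hy : y ∈ B <;> simp [hy]
    have e1 : ∫ q in Prod.snd ⁻¹' B, (bias ν' q.2 : ℝ) ∂(outLaw ν ⊗ₘ K) =
        (transition ν' false).real B - (outLaw ν').real B := by
      have hsnd : (outLaw ν ⊗ₘ K).map Prod.snd = outLaw ν' := by
        rw [outLaw_bind hK]; exact Measure.snd_compProd _ _
      have hm : Measurable fun y => (bias ν' y : ℝ) := by fun_prop
      rw [← setIntegral_map (f := fun y => (bias ν' y : ℝ)) hB hm.aestronglyMeasurable
        measurable_snd.aemeasurable, hsnd, ← integral_indicator hB]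
      have := integral_mul_bias ν' (measurable_one.indicator hB) hbd
      rw [integral_indicator_one hB, integral_indicator_one hB] at this
      rw [← this]
      congr 1 with y
      by_cases hy : y ∈ B <;> simp [hy]
    have e2 : ∫ q in Prod.snd ⁻¹' B, (bias ν q.1 : ℝ) ∂(outLaw ν ⊗ₘ K) =
        (transition ν' false).real B - (outLaw ν').real B := by
      -- Integrating out the degraded output replaces the event `B` by its kernel probability, a
      -- function of the original output with values in [0,1].
      have hKm : Measurable fun y => (K y).real B := (K.measurable_coe hB).ennreal_toReal
      rw [← integral_indicator hs, Measure.integral_compProd (hXi.indicator hs), hK,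
        outLaw_bind hK, ← integral_kernel_real _ K hB, ← integral_kernel_real _ K hB,
        ← integral_mul_bias ν hKm fun y => by
          rw [abs_of_nonneg measureReal_nonneg]; exact measureReal_le_one]
      congr 1 with y
      rw [← integral_indicator_one hB, ← integral_mul_const]
      congr 1 with z
      by_cases hz : z ∈ B <;> simp [hz]
    rw [e1, e2]
  · exact ((by fun_prop : Measurable fun y => (bias ν' y : ℝ)).comp
      (comap_measurable Prod.snd)).aestronglyMeasurable

/-- Conditional Jensen on the joint law of original and degraded outputs, whose marginals are the
two output laws. -/
lemma lessNoisy_biasLaw {ν ν' : Measure EReal} [IsProbabilityMeasure ν] [IsProbabilityMeasure ν']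
    (h : IsDegraded ν' ν) : LessNoisy (biasLaw ν) (biasLaw ν') := by
  obtain ⟨K, hKm, hK⟩ := h
  intro f hf hfc
  have hfc' : Continuous fun d : Bias => f d := continuousOn_iff_continuous_domRestrict.1 hfc
  obtain ⟨c, hc⟩ : ∃ c, ∀ d : Bias, |f d| ≤ c := by
    obtain ⟨c, hc⟩ := isCompact_univ.exists_bound_of_continuousOn hfc'.continuousOn
    exact ⟨c, fun d => hc d (mem_univ d)⟩
  have hfst : (outLaw ν ⊗ₘ K).map Prod.fst = outLaw ν := Measure.fst_compProd _ _
  have hsnd : (outLaw ν ⊗ₘ K).map Prod.snd = outLaw ν' := by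
    rw [outLaw_bind hK]; exact Measure.snd_compProd _ _
  have hm1 : Measurable fun y => f (bias ν y) := hfc'.measurable.comp (measurable_bias ν)
  have hm2 : Measurable fun y => f (bias ν' y) := hfc'.measurable.comp (measurable_bias ν')
  have hi1 : Integrable (fun q : EReal × EReal => f (bias ν q.1)) (outLaw ν ⊗ₘ K) :=
    integrable_of_bdd (hm1.comp measurable_fst) fun q => hc _
  have hi2 : Integrable (fun q : EReal × EReal => f (bias ν' q.2)) (outLaw ν ⊗ₘ K) :=
    integrable_of_bdd (hm2.comp measurable_snd) fun q => hc _
  have hX : Integrable (fun q : EReal × EReal => (bias ν q.1 : ℝ)) (outLaw ν ⊗ₘ K) :=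
    integrable_of_bdd (by fun_prop) fun q => abs_le.2 (bias ν q.1).2
  have hJ := hf.condExp_map_le (measurable_snd.comap_le :
      MeasurableSpace.comap Prod.snd _ ≤ (inferInstance : MeasurableSpace (EReal × EReal)))
    hfc.upperSemicontinuousOn (ae_of_all _ fun q => (bias ν q.1).2) isClosed_Icc hX hi1
  rw [integral_biasLaw ν hfc', integral_biasLaw ν' hfc', ← hfst, ← hsnd,
    integral_map measurable_fst.aemeasurable hm1.aestronglyMeasurable,
    integral_map measurable_snd.aemeasurable hm2.aestronglyMeasurable,
    ← integral_condExp (measurable_snd.comap_le :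
      MeasurableSpace.comap Prod.snd _ ≤ (inferInstance : MeasurableSpace (EReal × EReal)))]
  refine integral_mono_ae integrable_condExp hi2 ?_
  filter_upwards [hJ, condExp_bias hK] with q h1 h2
  refine h1.trans (le_of_eq ?_)
  rw [Function.comp_apply, ← h2]

/-! ### A single channel use -/

lemma one_add_bpsk_mul_le (b : Bool) (d : Bias) : |1 + bpsk b * (d : ℝ)| ≤ 2 := by
  have h := d.2
  rw [abs_of_nonneg (one_add_bpsk_mul_nonneg b h)]
  rcases bpsk_cases b with hb | hb <;> rw [hb] <;> linarith [h.1, h.2]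

lemma isLikelihood_single (p : Measure Bool) [IsProbabilityMeasure p] (ν : Measure EReal)
    [IsProbabilityMeasure ν] :
    IsLikelihood (singleLaw p ν) (fun ω => ω.1) singleOutput (outLaw ν)
      (fun b y => p.real {b} * (1 + bpsk b * bias ν y)) :=
  isLikelihood_prod p ν (outLaw ν) measurable_output (fun b => by fun_prop)
    (fun b y => one_add_bpsk_mul_nonneg b (bias ν y).2)
    ⟨2, fun b y => one_add_bpsk_mul_le b (bias ν y)⟩ fun b => transition_eq ν b

instance (p : Measure Bool) [IsProbabilityMeasure p] (ν : Measure EReal)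
    [IsProbabilityMeasure ν] : IsProbabilityMeasure (singleLaw p ν) := by
  unfold singleLaw; infer_instance

lemma real_true_add_real_false (p : Measure Bool) [IsProbabilityMeasure p] :
    p.real {true} + p.real {false} = 1 := by
  have := probReal_add_probReal_compl (μ := p) (MeasurableSet.singleton true)
  rwa [show ({true} : Set Bool)ᶜ = {false} by ext b; simp] at this

/-- The bias law is symmetric, so the integrand may be averaged over ±d, which turns the three
entropy terms into values of B plus the entropy of the input. -/
lemma condEntropy_single (p : Measure Bool) [IsProbabilityMeasure p] (ν : Measure EReal)
    [IsProbabilityMeasure ν] :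
    condEntropy (singleLaw p ν) (fun ω => ω.1) singleOutput =
      (negMulLog (p.real {true}) + negMulLog (p.real {false}) +
        ∫ d : Bias, (biasEnt d - biasEnt ((p.real {false} - p.real {true}) * d)) ∂biasLaw ν) /
          log 2 := by
  rw [(isLikelihood_single p ν).condEntropy_eq]
  congr 1
  have hs := real_true_add_real_false p
  set a := p.real {true} with ha
  set b := p.real {false} with hb
  set f : ℝ → ℝ := fun d => negMulLog (a * (1 - d)) + negMulLog (b * (1 + d)) -
    negMulLog (1 + (b - a) * d) with hf
  have hfc : Continuous f := by fun_prop
  have e : ∀ y, ∑ c, negMulLog (p.real {c} * (1 + bpsk c * bias ν y)) -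
      negMulLog (∑ c, p.real {c} * (1 + bpsk c * bias ν y)) = f (bias ν y) := fun y => by
    simp only [Fintype.sum_bool, bpsk, if_true, ← ha, ← hb, hf]
    rw [show a * (1 + -1 * (bias ν y : ℝ)) + b * (1 + (if false = true then -1 else 1) * bias ν y) =
      (a + b) + (b - a) * bias ν y by simp; ring, hs]
    simp [sub_eq_add_neg]
  simp only [e]
  rw [← integral_biasLaw ν (f := fun d => f d) (by fun_prop),
    (isSymmetricLaw_biasLaw ν).integral_eq hfc]
  have e2 : ∀ d : ℝ, (f d + f (-d)) / 2 =
      (negMulLog a + negMulLog b) + (biasEnt d - biasEnt ((b - a) * d)) := fun d => by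
    simp only [hf]
    rw [negMulLog_mul, negMulLog_mul, negMulLog_mul, negMulLog_mul, biasEnt, biasEnt, sub_neg_eq_add,
      mul_neg, ← sub_eq_add_neg, ← sub_eq_add_neg]
    linear_combination (negMulLog (1 + d) + negMulLog (1 - d)) / 2 * hs
  simp only [e2]
  rw [integral_add (integrable_const _) (integrable_of_continuous _ (by fun_prop))]
  simp

lemma entropy_single (p : Measure Bool) [IsProbabilityMeasure p] (ν : Measure EReal)
    [IsProbabilityMeasure ν] :
    entropy (singleLaw p ν) (fun ω => ω.1) =
      (negMulLog (p.real {true}) + negMulLog (p.real {false})) / log 2 := by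
  have h : ∀ b, (singleLaw p ν).real ((fun ω => ω.1) ⁻¹' {b}) = p.real {b} := fun b => by
    rw [singleLaw, show ((fun ω : Bool × EReal => ω.1) ⁻¹' {b}) = {b} ×ˢ univ by ext; simp,
      measureReal_prod_prod, probReal_univ, mul_one]
  simp only [entropy, h, Fintype.sum_bool]

instance : IsProbabilityMeasure unifBit := by
  unfold unifBit
  exact isProbabilityMeasure_uniformOn finite_univ univ_nonempty

lemma unifBit_real (b : Bool) : unifBit.real {b} = 1 / 2 := by
  rw [unifBit, measureReal_def, uniformOn_univ]
  simp

lemma chanEntropy_eq (ν : Measure EReal) [IsProbabilityMeasure ν] :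
    chanEntropy ν = 1 + (∫ d : Bias, biasEnt d ∂biasLaw ν) / log 2 := by
  have hl : log 2 ≠ 0 := (log_pos (by norm_num)).ne'
  have h2 : negMulLog (1 / 2 : ℝ) + negMulLog (1 / 2) = log 2 := by
    simp only [negMulLog, one_div, log_inv]; ring
  rw [chanEntropy, condEntropy_single, unifBit_real, unifBit_real, h2]
  simp only [sub_self, zero_mul, biasEnt_zero, sub_zero]
  field_simp

lemma chanMMSE_eq (ν : Measure EReal) [IsProbabilityMeasure ν] :
    chanMMSE ν = 1 - ∫ d : Bias, (d : ℝ) ^ 2 ∂biasLaw ν := by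
  have h := (isLikelihood_single unifBit ν).mmse_eq (φ := bpsk)
    (fun b => by rw [sq, bpsk_mul_self])
  rw [chanMMSE, h]
  have e1 : ∀ y, ∑ b, unifBit.real {b} * (1 + bpsk b * (bias ν y : ℝ)) = 1 := fun y => by
    simp only [Fintype.sum_bool, unifBit_real, bpsk]; simp; ring
  have e2 : ∀ y, ∑ b, bpsk b * (unifBit.real {b} * (1 + bpsk b * (bias ν y : ℝ))) = bias ν y :=
    fun y => by simp only [Fintype.sum_bool, unifBit_real, bpsk]; simp; ring
  simp only [IsLikelihood.estimator, e1, e2, one_mul, div_one]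
  rw [← integral_biasLaw ν (f := fun d => 1 - (d : ℝ) ^ 2) (by fun_prop),
    integral_sub (integrable_const _) (integrable_of_continuous _ (by fun_prop))]
  simp

/-- With τ the mean of the input, the mutual information in nats is E[B(τD)] - E[B(D)]. Since B ≤ 0
= B(0), it is largest at τ = 0, the uniform input. -/
lemma capacity_eq (ν : Measure EReal) [IsProbabilityMeasure ν] :
    capacity ν = 1 - chanEntropy ν := by
  have hl : 0 < log 2 := log_pos (by norm_num)
  have hle : ∀ p : ProbabilityMeasure Bool,
      mutualInfo (singleLaw (p : Measure Bool) ν) (fun ω => ω.1) singleOutput ≤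
        1 - chanEntropy ν := fun p => by
    have hs := real_true_add_real_false (p : Measure Bool)
    have h1 : 0 ≤ (p : Measure Bool).real {true} := measureReal_nonneg
    have h2 : 0 ≤ (p : Measure Bool).real {false} := measureReal_nonneg
    rw [mutualInfo, entropy_single, condEntropy_single, chanEntropy_eq, ← sub_div,
      sub_add_cancel_left, sub_add_cancel_left, ← neg_div]
    refine div_le_div_of_nonneg_right (neg_le_neg ?_) hl.le
    refine integral_mono (integrable_of_continuous _ (by fun_prop))
      (integrable_of_continuous _ (by fun_prop)) fun d => ?_
    have hτ : |(p : Measure Bool).real {false} - (p : Measure Bool).real {true}| ≤ 1 :=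
      abs_le.2 ⟨by linarith, by linarith⟩
    have := biasEnt_nonpos (d := ((p : Measure Bool).real {false} -
      (p : Measure Bool).real {true}) * d) (by
        rw [mem_Icc, ← abs_le, abs_mul]
        exact mul_le_one₀ hτ (abs_nonneg _) (abs_le.2 d.2))
    simp only
    linarith
  refine le_antisymm (ciSup_le hle) ?_
  refine le_trans (le_of_eq ?_) (le_ciSup ⟨_, forall_mem_range.2 hle⟩
    (⟨unifBit, inferInstance⟩ : ProbabilityMeasure Bool))
  have h2 : negMulLog (1 / 2 : ℝ) + negMulLog (1 / 2) = log 2 := by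
    simp only [negMulLog, one_div, log_inv]; ring
  rw [ProbabilityMeasure.coe_mk, mutualInfo, entropy_single, ← chanEntropy, unifBit_real,
    unifBit_real, h2, div_self hl.ne']

/-! ### Block transmission -/

section Block

lemma pi_withDensity {ι E : Type*} [Fintype ι] [MeasurableSpace E] (ρ : Measure E)
    [IsProbabilityMeasure ρ] {f : ι → E → ENNReal} (hf : ∀ j, Measurable (f j))
    [∀ j, SigmaFinite (ρ.withDensity (f j))] :
    Measure.pi (fun j => ρ.withDensity (f j)) =
      (Measure.pi fun _ : ι => ρ).withDensity fun y => ∏ j, f j (y j) := by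
  refine Measure.pi_eq fun s hs => ?_
  rw [withDensity_apply _ (MeasurableSet.univ_pi hs), ← lintegral_indicator
    (MeasurableSet.univ_pi hs)]
  have e : ∀ y : ι → E, (univ.pi s).indicator (fun y => ∏ j, f j (y j)) y =
      ∏ j, (s j).indicator (f j) (y j) := fun y => by
    by_cases hy : y ∈ univ.pi s
    · rw [indicator_of_mem hy]
      exact Finset.prod_congr rfl fun j _ => (indicator_of_mem (hy j (mem_univ j)) _).symm
    · rw [indicator_of_notMem hy]
      simp only [mem_pi, mem_univ, true_imp_iff, not_forall] at hy
      obtain ⟨j, hj⟩ := hy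
      exact (Finset.prod_eq_zero (Finset.mem_univ j) (indicator_of_notMem hj _)).symm
  simp only [e]
  have hm : ∀ j, Measurable ((s j).indicator (f j)) := fun j => (hf j).indicator (hs j)
  rw [lintegral_prod_eq_prod_lintegral_of_indepFun Finset.univ
    (fun j (y : ι → E) => (s j).indicator (f j) (y j))
    (iIndepFun_pi fun j => (hm j).aemeasurable)
    fun j => (hm j).comp (measurable_pi_apply j)]
  refine Finset.prod_congr rfl fun j _ => ?_
  rw [withDensity_apply _ (hs j), ← lintegral_indicator (hs j),
    ← (measurePreserving_eval (fun _ : ι => ρ) j).lintegral_comp (hm j)]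

lemma measurePreserving_restrict_ne {ι E : Type*} [Fintype ι] [DecidableEq ι] [MeasurableSpace E]
    (ρ : Measure E) [IsProbabilityMeasure ρ] (i : ι) :
    MeasurePreserving (fun (y : ι → E) (j : {j // j ≠ i}) => y j) (Measure.pi fun _ => ρ)
      (Measure.pi fun _ => ρ) :=
  measurePreserving_fst.comp (measurePreserving_piEquivPiSubtypeProd (fun _ => ρ) fun j => j ≠ i)

variable {N : ℕ}

lemma isProbabilityMeasure_codeLaw {C : Finset (Fin N → Bool)} (hC : C.Nonempty) :
    IsProbabilityMeasure (codeLaw C) :=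
  isProbabilityMeasure_uniformOn C.finite_toSet (Finset.coe_nonempty.2 hC)

lemma map_extrinsic (ν : Measure EReal) [IsProbabilityMeasure ν] (i : Fin N) (x : Fin N → Bool) :
    (Measure.pi fun _ : Fin N => ν).map (fun z (j : {j // j ≠ i}) => output (x j) (z j)) =
      (Measure.pi fun _ : {j // j ≠ i} => outLaw ν).withDensity fun y =>
        ENNReal.ofReal (∏ j : {j // j ≠ i}, (1 + bpsk (x j) * (bias ν (y j) : ℝ))) := by
  have h1 := (measurePreserving_restrict_ne ν i).map_eq
  have h2 : (fun (z : Fin N → EReal) (j : {j // j ≠ i}) => output (x j) (z j)) =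
      (fun (y : {j // j ≠ i} → EReal) (j : {j // j ≠ i}) => output (x j) (y j)) ∘
        fun z j => z j := rfl
  have hm : Measurable fun (y : {j // j ≠ i} → EReal) (j : {j // j ≠ i}) => output (x j) (y j) :=
    measurable_pi_lambda _ fun j => (measurable_output _).comp (measurable_pi_apply j)
  have hp : ∀ j : {j // j ≠ i}, IsProbabilityMeasure (ν.map (output (x j))) := fun j =>
    (inferInstance : IsProbabilityMeasure (transition ν (x j)))
  have ht : ∀ j : {j // j ≠ i}, ν.map (output (x j)) =
      (outLaw ν).withDensity fun y => ENNReal.ofReal (1 + bpsk (x j) * bias ν y) :=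
    fun j => transition_eq ν (x j)
  rw [h2, ← Measure.map_map hm (measurePreserving_restrict_ne ν i).measurable, h1,
    Measure.pi_map_pi fun j => (measurable_output _).aemeasurable]
  simp only [ht] at hp ⊢
  rw [pi_withDensity (outLaw ν) fun j => by fun_prop]
  congr 1 with y
  rw [ENNReal.ofReal_prod_of_nonneg fun j _ => one_add_bpsk_mul_nonneg _ (bias ν (y j)).2]

lemma isLikelihood_extrinsic {C : Finset (Fin N → Bool)} (hC : C.Nonempty) (ν : Measure EReal)
    [IsProbabilityMeasure ν] (i : Fin N) :
    IsLikelihood (blockLaw C ν) (fun ω => ω.1) (extrinsicOutput i)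
      (Measure.pi fun _ : {j // j ≠ i} => outLaw ν)
      (fun x y => (codeLaw C).real {x} * ∏ j : {j // j ≠ i}, (1 + bpsk (x j) * (bias ν (y j) : ℝ))) := by
  have := isProbabilityMeasure_codeLaw hC
  refine isLikelihood_prod (codeLaw C) (Measure.pi fun _ => ν) _
    (F := fun x (z : Fin N → EReal) (j : {j // j ≠ i}) => output (x j) (z j))
    (l := fun x y => ∏ j : {j // j ≠ i}, (1 + bpsk (x j) * (bias ν (y j) : ℝ))) (fun x => ?_)
    (fun x => by fun_prop) (fun x y => ?_) ⟨∏ _j : {j // j ≠ i}, 2, fun x y => ?_⟩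
    fun x => map_extrinsic ν i x
  · exact measurable_pi_lambda _ fun j => (measurable_output _).comp (measurable_pi_apply _)
  · exact Finset.prod_nonneg fun j _ => one_add_bpsk_mul_nonneg _ (bias ν (y j)).2
  · rw [Finset.abs_prod]
    exact Finset.prod_le_prod (fun j _ => abs_nonneg _) fun j _ =>
      one_add_bpsk_mul_le _ (bias ν (y j))

/-- The biases of the outputs are sufficient: the joint density given a codeword depends on the
outputs only through them. The bias at position i is added as a dummy variable. -/
lemma extrinsicMMSE_eq {C : Finset (Fin N → Bool)} (hC : C.Nonempty) (ν : Measure EReal)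
    [IsProbabilityMeasure ν] (i : Fin N) :
    extrinsicMMSE C ν i =
      blockMMSE (fun x => (codeLaw C).real {x}) i (fun _ => biasLaw ν) := by
  have := isProbabilityMeasure_codeLaw hC
  have hpb : IsProbabilityMeasure (blockLaw C ν) := by unfold blockLaw; infer_instance
  have h := isLikelihood_extrinsic hC ν i
  have hp : ∀ x, 0 ≤ (codeLaw C).real {x} := fun x => measureReal_nonneg
  rw [extrinsicMMSE, h.mmse_eq (φ := fun x => bpsk (x i)) fun x => by rw [sq, bpsk_mul_self],
    blockMMSE]
  have hb : (Measure.pi fun _ : Fin N => biasLaw ν) =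
      (Measure.pi fun _ => outLaw ν).map fun y j => bias ν (y j) :=
    (Measure.pi_map_pi (hμ := fun _ => (inferInstance : SigmaFinite (biasLaw ν)))
      fun j => (measurable_bias ν).aemeasurable).symm
  have hbm : Measurable fun (y : Fin N → EReal) (j : Fin N) => bias ν (y j) :=
    measurable_pi_lambda _ fun j => (measurable_bias ν).comp (measurable_pi_apply j)
  rw [hb, integral_map hbm.aemeasurable
    (continuous_errDensity_toVec hp i).aestronglyMeasurable,
    ← (measurePreserving_restrict_ne (outLaw ν) i).map_eq,
    integral_map (measurePreserving_restrict_ne (outLaw ν) i).measurable.aemeasurable]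
  · congr 1 with y
    have hl : ∀ x : Fin N → Bool, ∏ j : {j // j ≠ i}, (1 + bpsk (x j) * (bias ν (y j) : ℝ)) =
        lik (Finset.univ.erase i) x (toVec fun j => bias ν (y j)) := fun x =>
      (Finset.prod_subtype (Finset.univ.erase i) (by simp)
        fun j => 1 + bpsk (x j) * (bias ν (y j) : ℝ)).symm
    simp only [IsLikelihood.estimator, hl, errDensity, postMean, evidence, corr]
    simp only [mul_left_comm, mul_comm]
  · have h1 : Measurable fun y : {j // j ≠ i} → EReal => ∑ a : Fin N → Bool, (codeLaw C).real {a} *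
        ∏ j : {j // j ≠ i}, (1 + bpsk (a j) * (bias ν (y j) : ℝ)) :=
      Finset.measurable_fun_sum _ fun a _ => h.measurable a
    exact (h1.mul (((h.measurable_estimator _).pow_const 2).const_sub 1)).aestronglyMeasurable

end Block

/-! ### Real analysis -/

/-- A function whose increments are bounded by those of the left Riemann sums of an antitone
function is bounded by the integral. -/
lemma sub_le_integral_of_antitoneOn {a b : ℝ} (hab : a ≤ b) {g Φ : ℝ → ℝ}
    (hg : AntitoneOn g (Icc a b))
    (h : ∀ x ∈ Icc a b, ∀ y ∈ Icc a b, x ≤ y → Φ y - Φ x ≤ g x * (y - x)) :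
    Φ b - Φ a ≤ ∫ x in a..b, g x := by
  -- For an equipartition into n cells, right sums of an antitone function lie below the integral,
  -- and left sums exceed them by exactly the mesh times g a - g b.
  have key : ∀ n : ℕ, 0 < n →
      Φ b - Φ a ≤ (∫ x in a..b, g x) + (b - a) * (g a - g b) / n := by
    intro n hn
    have hn' : (0 : ℝ) < n := by exact_mod_cast hn
    set δ := (b - a) / n with hδ
    have hδ0 : 0 ≤ δ := div_nonneg (by linarith) hn'.le
    have hδn : δ * n = b - a := by rw [hδ]; field_simp
    have hmem : ∀ u ∈ Icc (0 : ℝ) n, a + δ * u ∈ Icc a b := fun u hu =>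
      ⟨by nlinarith [hu.1], by nlinarith [hu.2]⟩
    have hmem' : ∀ k : ℕ, k ≤ n → a + δ * k ∈ Icc a b := fun k hk =>
      hmem k ⟨by positivity, by exact_mod_cast hk⟩
    have hant : AntitoneOn (fun u => g (a + δ * u)) (Icc (0 : ℝ) (0 + n)) := by
      rw [zero_add]
      exact fun u hu v hv huv => hg (hmem u hu) (hmem v hv) (by nlinarith)
    have h1 := hant.sum_le_integral
    simp only [zero_add] at h1
    have h2 : δ * ∫ u in (0 : ℝ)..n, g (a + δ * u) = ∫ x in a..b, g x := by
      rw [← smul_eq_mul, intervalIntegral.smul_integral_comp_add_mul, hδn]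
      simp
    have h3 : ∑ k ∈ Finset.range n, (Φ (a + δ * (k + 1 : ℕ)) - Φ (a + δ * (k : ℕ))) =
        Φ b - Φ a := by
      rw [Finset.sum_range_sub (fun k : ℕ => Φ (a + δ * k)), hδn]
      simp
    have h4 : ∑ k ∈ Finset.range n, (Φ (a + δ * (k + 1 : ℕ)) - Φ (a + δ * (k : ℕ))) ≤
        ∑ k ∈ Finset.range n, g (a + δ * k) * δ := by
      refine Finset.sum_le_sum fun k hk => ?_
      have hk' := Finset.mem_range.1 hk
      refine (h _ (hmem' k hk'.le) _ (hmem' (k + 1) hk') (by push_cast; nlinarith)).trans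
        (le_of_eq ?_)
      push_cast
      ring
    have h5 : ∑ k ∈ Finset.range n, g (a + δ * k) =
        ∑ k ∈ Finset.range n, g (a + δ * (k + 1 : ℕ)) + (g a - g b) := by
      have := Finset.sum_range_sub (fun k : ℕ => g (a + δ * k)) n
      rw [Finset.sum_sub_distrib, hδn] at this
      simp only [Nat.cast_zero, mul_zero, add_zero, add_sub_cancel] at this
      linarith
    rw [h3, ← Finset.sum_mul, h5] at h4
    calc Φ b - Φ a ≤ δ * ∑ k ∈ Finset.range n, g (a + δ * (k + 1 : ℕ)) + δ * (g a - g b) := by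
          linarith
      _ ≤ (∫ x in a..b, g x) + δ * (g a - g b) := by
          rw [← h2]; gcongr
      _ = _ := by rw [hδ]; ring
  have ht : Filter.Tendsto (fun n : ℕ => (∫ x in a..b, g x) + (b - a) * (g a - g b) / n)
      Filter.atTop (nhds ((∫ x in a..b, g x) + 0)) :=
    (tendsto_const_div_atTop_nhds_zero_nat _).const_add _
  rw [add_zero] at ht
  exact ge_of_tendsto ht (Filter.eventually_atTop.2 ⟨1, fun n hn => key n hn⟩)

/-- Absolute continuity makes the increment the integral of the derivative, which is at most κ
inside the interval; there the derivative within [0,1] is the ordinary one. -/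
lemma chanEntropy_sub_le_kappa {ν : ℝ → Measure EReal}
    (hac : AbsolutelyContinuousOnInterval (fun t => chanEntropy (ν t)) 0 1) {t : ℝ} (ht : 0 ≤ t)
    (hk : kappa ν t ≠ ⊤) {x y : ℝ} (hx : t ≤ x) (hxy : x ≤ y) (hy : y ≤ 1) :
    chanEntropy (ν y) - chanEntropy (ν x) ≤ (kappa ν t).toReal * (y - x) := by
  have hac' := hac.mono (c := x) (d := y) (by
    rw [uIcc_of_le hxy, uIcc_of_le zero_le_one]; exact Icc_subset_Icc (by linarith) hy)
  rw [← hac'.integral_deriv_eq_sub]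
  have : ∫ _ in x..y, (kappa ν t).toReal = (kappa ν t).toReal * (y - x) := by
    rw [intervalIntegral.integral_const, smul_eq_mul, mul_comm]
  rw [← this]
  refine intervalIntegral.integral_mono_on_of_le_Ioo hxy hac'.intervalIntegrable_deriv
    (by simp) fun s hs => ?_
  have hs' : Icc (0 : ℝ) 1 ∈ nhds s := Icc_mem_nhds (by linarith [hs.1]) (by linarith [hs.2])
  rw [← derivWithin_of_mem_nhds hs']
  have hle : ENNReal.ofReal (derivWithin (fun u => chanEntropy (ν u)) (Icc 0 1) s) ≤ kappa ν t :=
    le_iSup₂ (f := fun s (_ : s ∈ Icc t 1) =>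
      ENNReal.ofReal (derivWithin (fun u => chanEntropy (ν u)) (Icc 0 1) s)) s
      ⟨by linarith [hs.1], by linarith [hs.2]⟩
  exact (ENNReal.ofReal_le_iff_le_toReal hk).1 hle

/-! ### Integrals of a monotone function with values in [0,1]. -/

section Monotone

variable {M : ℝ → ℝ}

lemma intervalIntegrable_of_monotoneOn (hM : MonotoneOn M (Icc 0 1)) {a b : ℝ} (ha : 0 ≤ a) (hab : a ≤ b) (hb : b ≤ 1) :
    IntervalIntegrable M volume a b :=
  MonotoneOn.intervalIntegrable (by
    rw [uIcc_of_le hab]; exact hM.mono (Icc_subset_Icc ha hb))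

lemma intervalIntegrable_mul_one_sub (hM : MonotoneOn M (Icc 0 1))
    (hM0 : ∀ s ∈ Icc (0 : ℝ) 1, M s ∈ Icc (0 : ℝ) 1) {a b : ℝ} (ha : 0 ≤ a) (hab : a ≤ b) (hb : b ≤ 1) :
    IntervalIntegrable (fun s => M s * (1 - M s)) volume a b := by
  have h2 : MonotoneOn (fun s => M s ^ 2) (Icc 0 1) := fun x hx y hy hxy =>
    pow_le_pow_left₀ (hM0 x hx).1 (hM hx hy hxy) 2
  have := (intervalIntegrable_of_monotoneOn hM ha hab hb).sub
    (intervalIntegrable_of_monotoneOn h2 ha hab hb)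
  refine this.congr fun s _ => ?_
  ring

lemma mul_integral_one_sub_le (hM : MonotoneOn M (Icc 0 1))
    (hM0 : ∀ s ∈ Icc (0 : ℝ) 1, M s ∈ Icc (0 : ℝ) 1) {a b : ℝ} (ha : 0 ≤ a) (hab : a ≤ b) (hb : b ≤ 1) :
    M a * ∫ s in a..b, (1 - M s) ≤ ∫ s in a..b, M s * (1 - M s) := by
  rw [← intervalIntegral.integral_const_mul]
  refine intervalIntegral.integral_mono_on hab
    ((intervalIntegrable_const.sub (intervalIntegrable_of_monotoneOn hM ha hab hb)).const_mul _)
    (intervalIntegrable_mul_one_sub hM hM0 ha hab hb) fun s hs => ?_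
  have hs' : s ∈ Icc (0 : ℝ) 1 := ⟨by linarith [hs.1], by linarith [hs.2]⟩
  exact mul_le_mul_of_nonneg_right (hM ⟨ha, by linarith⟩ hs' hs.1) (by linarith [(hM0 s hs').2])

lemma one_sub_mul_integral_le (hM : MonotoneOn M (Icc 0 1))
    (hM0 : ∀ s ∈ Icc (0 : ℝ) 1, M s ∈ Icc (0 : ℝ) 1) {a b : ℝ} (ha : 0 ≤ a) (hab : a ≤ b) (hb : b ≤ 1) :
    (1 - M b) * ∫ s in a..b, M s ≤ ∫ s in a..b, M s * (1 - M s) := by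
  rw [← intervalIntegral.integral_const_mul]
  refine intervalIntegral.integral_mono_on hab
    ((intervalIntegrable_of_monotoneOn hM ha hab hb).const_mul _)
    (intervalIntegrable_mul_one_sub hM hM0 ha hab hb) fun s hs => ?_
  have hs' : s ∈ Icc (0 : ℝ) 1 := ⟨by linarith [hs.1], by linarith [hs.2]⟩
  rw [mul_comm]
  exact mul_le_mul_of_nonneg_left (by linarith [hM hs' ⟨by linarith, hb⟩ hs.2]) (hM0 s hs').1

end Monotone

/-! ### The code -/

section Code

variable {N : ℕ} {C : Finset (Fin N → Bool)}

lemma codeLaw_real (x : Fin N → Bool) :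
    (codeLaw C).real {x} = if x ∈ C then (C.card : ℝ)⁻¹ else 0 := by
  rw [codeLaw, measureReal_def, ← Finset.coe_singleton, uniformOn_apply_finset]
  by_cases h : x ∈ C <;> simp [h]

lemma sum_codeLaw (hC : C.Nonempty) : ∑ x, (codeLaw C).real {x} = 1 := by
  have : (C.card : ℝ) ≠ 0 := by exact_mod_cast hC.card_ne_zero
  simp only [codeLaw_real, Finset.sum_ite_mem, Finset.univ_inter, Finset.sum_const, nsmul_eq_mul]
  exact mul_inv_cancel₀ this

lemma sum_negMulLog_codeLaw (hC : C.Nonempty) :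
    ∑ x, negMulLog ((codeLaw C).real {x}) = log C.card := by
  have : (C.card : ℝ) ≠ 0 := by exact_mod_cast hC.card_ne_zero
  simp only [codeLaw_real, apply_ite negMulLog, negMulLog_zero, Finset.sum_ite_mem,
    Finset.univ_inter, Finset.sum_const, nsmul_eq_mul]
  rw [negMulLog, log_inv]
  field_simp

lemma measureReal_singleton_perm {μ : Measure (Fin N → Bool)} {σ : Equiv.Perm (Fin N)}
    (h : μ.map (fun x k => x (σ k)) = μ) (x : Fin N → Bool) :
    μ.real {fun k => x (σ k)} = μ.real {x} := by
  rw [measureReal_def, measureReal_def]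
  conv_lhs => rw [← h]
  rw [Measure.map_apply (by fun_prop) (MeasurableSet.singleton _)]
  congr 2
  ext y
  simp only [mem_preimage, mem_singleton_iff]
  refine ⟨fun hy => ?_, fun hy => by rw [hy]⟩
  ext k
  have := congrFun hy (σ.symm k)
  simpa using this

lemma blockMMSE_codeLaw_eq (hsymm : HasTransitiveSymmetry (codeLaw C)) (i j : Fin N)
    (m : Measure Bias) [IsProbabilityMeasure m] :
    blockMMSE (fun x => (codeLaw C).real {x}) i (fun _ => m) =
      blockMMSE (fun x => (codeLaw C).real {x}) j (fun _ => m) := by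
  obtain ⟨σ, hσ, rfl⟩ := hsymm j i
  exact blockMMSE_perm σ (measureReal_singleton_perm hσ) j m

lemma rate_mul_log (hN : 0 < N) : N * log 2 * rate C = log C.card := by
  have : (N : ℝ) ≠ 0 := by exact_mod_cast hN.ne'
  have hl : log 2 ≠ 0 := (log_pos (by norm_num)).ne'
  rw [rate, logb]
  field_simp

lemma rate_mem (hN : 0 < N) (hC : C.Nonempty) : rate C ∈ Icc (0 : ℝ) 1 := by
  have hN' : (0 : ℝ) < N := by exact_mod_cast hN
  have h1 : (1 : ℝ) ≤ C.card := by exact_mod_cast hC.card_pos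
  refine ⟨div_nonneg (logb_nonneg (by norm_num) h1) hN'.le, ?_⟩
  rw [rate, div_le_one hN', logb_le_iff_le_rpow (by norm_num) (by linarith)]
  have : C.card ≤ 2 ^ N := by
    simpa using C.card_le_univ
  rw [rpow_natCast]
  exact_mod_cast this

end Code

/-! ### Families of channels -/

section Family

variable {ν : ℝ → Measure EReal}

lemma IsAdmissibleFamily.continuousOn_chanEntropy (hν : IsAdmissibleFamily ν) :
    ContinuousOn (fun t => chanEntropy (ν t)) (Icc 0 1) := by
  have := hν.absolutelyContinuous.continuousOn
  rwa [uIcc_of_le zero_le_one] at this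

variable [∀ t, IsProbabilityMeasure (ν t)]

lemma IsAdmissibleFamily.lessNoisy (hν : IsAdmissibleFamily ν) {s t : ℝ} (hs : 0 ≤ s)
    (hst : s ≤ t) (ht : t ≤ 1) : LessNoisy (biasLaw (ν s)) (biasLaw (ν t)) :=
  lessNoisy_biasLaw (hν.degraded s t hs hst ht)

lemma IsAdmissibleFamily.integral_sq (hν : IsAdmissibleFamily ν) {t : ℝ}
    (ht : t ∈ Icc (0 : ℝ) 1) : ∫ d : Bias, (d : ℝ) ^ 2 ∂biasLaw (ν t) = 1 - t := by
  have := hν.mmse_eq t ht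
  rw [chanMMSE_eq] at this
  linarith

lemma IsAdmissibleFamily.ae_perfect (hν : IsAdmissibleFamily ν) :
    ∀ᵐ u : Bias ∂biasLaw (ν 0), (u : ℝ) ^ 2 = 1 := by
  have h := hν.integral_sq (t := 0) (by simp)
  have hi : Integrable (fun d : Bias => 1 - (d : ℝ) ^ 2) (biasLaw (ν 0)) :=
    integrable_of_continuous _ (by fun_prop)
  have h0 : ∫ d : Bias, (1 - (d : ℝ) ^ 2) ∂biasLaw (ν 0) = 0 := by
    rw [integral_sub (integrable_const _) (integrable_of_continuous _ (by fun_prop)), h]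
    simp
  rw [integral_eq_zero_iff_of_nonneg (fun d => by
    have := d.2
    simp only [Pi.zero_apply]
    nlinarith [this.1, this.2]) hi] at h0
  filter_upwards [h0] with u hu
  simp only [Pi.zero_apply] at hu
  linarith

lemma IsAdmissibleFamily.ae_uninformative (hν : IsAdmissibleFamily ν) :
    ∀ᵐ u : Bias ∂biasLaw (ν 1), (u : ℝ) = 0 := by
  have h := hν.integral_sq (t := 1) (by simp)
  have hi : Integrable (fun d : Bias => (d : ℝ) ^ 2) (biasLaw (ν 1)) :=
    integrable_of_continuous _ (by fun_prop)
  rw [sub_self, integral_eq_zero_iff_of_nonneg (fun d => sq_nonneg _) hi] at h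
  filter_upwards [h] with u hu
  exact pow_eq_zero_iff two_ne_zero |>.1 hu

lemma IsAdmissibleFamily.chanEntropy_zero (hν : IsAdmissibleFamily ν) :
    chanEntropy (ν 0) = 0 := by
  have h : ∫ d : Bias, biasEnt d ∂biasLaw (ν 0) = -log 2 := by
    rw [integral_congr_ae (g := fun _ => -log 2)]
    · simp
    · filter_upwards [hν.ae_perfect] with u hu
      rcases mul_self_eq_one_iff.1 (sq (u : ℝ) ▸ hu) with h | h <;> simp [h]
  rw [chanEntropy_eq, h, neg_div, div_self (log_pos (by norm_num)).ne']
  ring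

lemma IsAdmissibleFamily.chanEntropy_one (hν : IsAdmissibleFamily ν) :
    chanEntropy (ν 1) = 1 := by
  have h : ∫ d : Bias, biasEnt d ∂biasLaw (ν 1) = 0 := by
    refine integral_eq_zero_of_ae ?_
    filter_upwards [hν.ae_uninformative] with u hu
    simp [hu]
  rw [chanEntropy_eq, h]
  simp

/-- The order applied to B(d) + d²/2, together with E[D²] = 1 - t, shows that E[B(D)] grows by at
least (t - s)/2. -/
lemma IsAdmissibleFamily.strictMonoOn_chanEntropy (hν : IsAdmissibleFamily ν) :
    StrictMonoOn (fun t => chanEntropy (ν t)) (Icc 0 1) := by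
  intro s hs t ht hst
  have hl : 0 < log 2 := log_pos (by norm_num)
  have h := hν.lessNoisy hs.1 hst.le ht.2 _ concaveOn_biasEnt_add_sq
    (Continuous.continuousOn (by fun_prop))
  have e : ∀ m : Measure Bias, [IsProbabilityMeasure m] →
      ∫ d : Bias, (biasEnt d + (d : ℝ) ^ 2 / 2) ∂m =
        ∫ d : Bias, biasEnt d ∂m + (∫ d : Bias, (d : ℝ) ^ 2 ∂m) / 2 := fun m _ => by
    rw [integral_add (integrable_of_continuous _ (by fun_prop))
      (integrable_of_continuous _ (by fun_prop)), integral_div]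
  rw [e, e, hν.integral_sq hs, hν.integral_sq ht] at h
  simp only [chanEntropy_eq]
  have := div_lt_div_of_pos_right (show ∫ d : Bias, biasEnt d ∂biasLaw (ν s) <
    ∫ d : Bias, biasEnt d ∂biasLaw (ν t) by linarith) hl
  linarith

/-! ### Conditional entropy rate of the code. -/

variable {N : ℕ} {C : Finset (Fin N → Bool)}

/-- Conditional entropy, in bits per symbol, of the codeword given the channel output. -/
noncomputable def condRate (C : Finset (Fin N → Bool)) (ν : Measure EReal) : ℝ :=
  blockEnt (fun x => (codeLaw C).real {x}) (fun _ => biasLaw ν) / (N * log 2)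

lemma extrinsicMMSE_mem (hC : C.Nonempty) (i : Fin N) (t : ℝ) :
    extrinsicMMSE C (ν t) i ∈ Icc (0 : ℝ) 1 := by
  rw [extrinsicMMSE_eq hC]
  exact ⟨blockMMSE_nonneg (fun x => measureReal_nonneg) i _,
    blockMMSE_le_one (fun x => measureReal_nonneg) (sum_codeLaw hC) i _
      fun _ => isSymmetricLaw_biasLaw _⟩

lemma IsAdmissibleFamily.monotoneOn_extrinsicMMSE (hν : IsAdmissibleFamily ν) (hC : C.Nonempty)
    (i : Fin N) : MonotoneOn (fun t => extrinsicMMSE C (ν t) i) (Icc 0 1) := by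
  intro s hs t ht hst
  simp only [extrinsicMMSE_eq hC]
  exact blockMMSE_mono (fun x => measureReal_nonneg) i (hν.lessNoisy hs.1 hst ht.2)

lemma IsAdmissibleFamily.condRate_zero (hν : IsAdmissibleFamily ν) : condRate C (ν 0) = 0 := by
  rw [condRate, blockEnt_of_perfect _ hν.ae_perfect, zero_div]

lemma IsAdmissibleFamily.condRate_one (hν : IsAdmissibleFamily ν) (hN : 0 < N)
    (hC : C.Nonempty) : condRate C (ν 1) = rate C := by
  have hN' : (0 : ℝ) < N := by exact_mod_cast hN
  have hl : 0 < log 2 := log_pos (by norm_num)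
  rw [condRate, blockEnt_of_uninformative (sum_codeLaw hC) hν.ae_uninformative,
    sum_negMulLog_codeLaw hC, ← rate_mul_log hN]
  field_simp

/-- The conditional entropy rate of the code increases at least by `M` times the increase of the
entropy of a single channel use. -/
lemma IsAdmissibleFamily.le_condRate_sub (hν : IsAdmissibleFamily ν) (hN : 0 < N)
    (hC : C.Nonempty) (hsymm : HasTransitiveSymmetry (codeLaw C)) (i : Fin N) {s t : ℝ}
    (hs : 0 ≤ s) (hst : s ≤ t) (ht : t ≤ 1) :
    extrinsicMMSE C (ν s) i * (chanEntropy (ν t) - chanEntropy (ν s)) ≤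
      condRate C (ν t) - condRate C (ν s) := by
  have hN' : (0 : ℝ) < N := by exact_mod_cast hN
  have hl : 0 < log 2 := log_pos (by norm_num)
  have h := le_blockEnt_sub (p := fun x => (codeLaw C).real {x}) (fun x => measureReal_nonneg)
    (isSymmetricLaw_biasLaw (ν s)) (isSymmetricLaw_biasLaw (ν t)) (hν.lessNoisy hs hst ht)
  simp only [blockMMSE_codeLaw_eq hsymm _ i, Finset.sum_const, Finset.card_univ, Fintype.card_fin,
    nsmul_eq_mul] at h
  rw [condRate, condRate, ← sub_div, le_div_iff₀ (by positivity), chanEntropy_eq, chanEntropy_eq,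
    extrinsicMMSE_eq hC]
  refine le_trans (le_of_eq ?_) h
  field_simp
  ring

/-- The conditional entropy rate of the code increases at most by the increase of the entropy of a
single channel use. -/
lemma IsAdmissibleFamily.condRate_sub_le (hν : IsAdmissibleFamily ν) (hN : 0 < N)
    (hC : C.Nonempty) {s t : ℝ} (hs : 0 ≤ s) (hst : s ≤ t) (ht : t ≤ 1) :
    condRate C (ν t) - condRate C (ν s) ≤ chanEntropy (ν t) - chanEntropy (ν s) := by
  have hN' : (0 : ℝ) < N := by exact_mod_cast hN
  have hl : 0 < log 2 := log_pos (by norm_num)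
  have h := blockEnt_sub_le (p := fun x => (codeLaw C).real {x}) (fun x => measureReal_nonneg)
    (sum_codeLaw hC) (isSymmetricLaw_biasLaw (ν s)) (isSymmetricLaw_biasLaw (ν t))
    (hν.lessNoisy hs hst ht)
  simp only [Finset.sum_const, Finset.card_univ, Fintype.card_fin, nsmul_eq_mul] at h
  rw [condRate, condRate, ← sub_div, div_le_iff₀ (by positivity), chanEntropy_eq, chanEntropy_eq]
  refine h.trans (le_of_eq ?_)
  field_simp
  ring

/-- All positions are degraded from the perfect channel at parameter 0, where the conditional
entropy is zero; transitivity makes the N contributions equal. -/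
lemma IsAdmissibleFamily.condRate_le (hν : IsAdmissibleFamily ν) (hN : 0 < N)
    (hC : C.Nonempty) (hsymm : HasTransitiveSymmetry (codeLaw C)) (i : Fin N) {t : ℝ}
    (ht : t ∈ Icc (0 : ℝ) 1) :
    condRate C (ν t) ≤ 1 + biasEnt (√(1 - extrinsicMMSE C (ν t) i)) / log 2 := by
  have hN' : (0 : ℝ) < N := by exact_mod_cast hN
  have hl : 0 < log 2 := log_pos (by norm_num)
  have h := blockEnt_sub_le_of_perfect (p := fun x => (codeLaw C).real {x})
    (fun x => measureReal_nonneg) (sum_codeLaw hC) (isSymmetricLaw_biasLaw (ν 0))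
    (isSymmetricLaw_biasLaw (ν t)) (hν.lessNoisy le_rfl ht.1 ht.2) hν.ae_perfect
  simp only [blockMMSE_codeLaw_eq hsymm _ i, Finset.sum_const, Finset.card_univ, Fintype.card_fin,
    nsmul_eq_mul, blockEnt_of_perfect _ hν.ae_perfect, sub_zero] at h
  rw [condRate, div_le_iff₀ (by positivity), extrinsicMMSE_eq hC]
  refine h.trans (le_of_eq ?_)
  field_simp

lemma IsAdmissibleFamily.condRate_nonneg (hν : IsAdmissibleFamily ν) (hN : 0 < N)
    (hC : C.Nonempty) (hsymm : HasTransitiveSymmetry (codeLaw C)) {t : ℝ}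
    (ht : t ∈ Icc (0 : ℝ) 1) : 0 ≤ condRate C (ν t) := by
  have h := hν.le_condRate_sub hN hC hsymm ⟨0, hN⟩ le_rfl ht.1 ht.2
  have hm := hν.strictMonoOn_chanEntropy.monotoneOn (by simp) ht ht.1
  rw [hν.condRate_zero, sub_zero] at h
  exact (mul_nonneg (extrinsicMMSE_mem hC _ 0).1 (sub_nonneg.2 hm)).trans h

/-- The gap to capacity is controlled by the area under `1 - M`. -/
lemma IsAdmissibleFamily.capacity_sub_rate_le (hν : IsAdmissibleFamily ν) (hN : 0 < N)
    (hC : C.Nonempty) (hsymm : HasTransitiveSymmetry (codeLaw C)) (i : Fin N) {t : ℝ}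
    (ht : t ∈ Icc (0 : ℝ) 1) (hk : kappa ν t ≠ ⊤) :
    capacity (ν t) - rate C ≤
      (kappa ν t).toReal * ∫ s in t..1, (1 - extrinsicMMSE C (ν s) i) := by
  have hM := hν.monotoneOn_extrinsicMMSE hC i
  have hsub : ∀ x ∈ Icc t 1, x ∈ Icc (0 : ℝ) 1 := fun x hx => ⟨ht.1.trans hx.1, hx.2⟩
  have h := sub_le_integral_of_antitoneOn (a := t) (b := 1) ht.2
    (g := fun s => (kappa ν t).toReal * (1 - extrinsicMMSE C (ν s) i))
    (Φ := fun s => chanEntropy (ν s) - condRate C (ν s))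
    (fun x hx y hy hxy => mul_le_mul_of_nonneg_left
      (sub_le_sub_left (hM (hsub x hx) (hsub y hy) hxy) 1) ENNReal.toReal_nonneg)
    (fun x hx y hy hxy => by
      have h1 := hν.le_condRate_sub hN hC hsymm i (hsub x hx).1 hxy hy.2
      have h2 := chanEntropy_sub_le_kappa hν.absolutelyContinuous ht.1 hk hx.1 hxy hy.2
      -- The sign of 1 - M(x) is needed to multiply the κ-bound on the increment of H.
      have h3 := (extrinsicMMSE_mem (ν := ν) hC i x).2
      nlinarith)
  simp only [hν.chanEntropy_one, hν.condRate_one hN hC] at h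
  rw [intervalIntegral.integral_const_mul] at h
  rw [capacity_eq]
  linarith [hν.condRate_nonneg hN hC hsymm ht]

/-- The rate h grows from t to 1 by at most C(t), so R - C(t) ≤ h(t). By `condRate_le` this is at
most the binary entropy whose ψ-value is the MMSE, and ψ is increasing. -/
lemma IsAdmissibleFamily.psi_le_extrinsicMMSE (hν : IsAdmissibleFamily ν) (hN : 0 < N)
    (hC : C.Nonempty) (hsymm : HasTransitiveSymmetry (codeLaw C)) (i : Fin N) {t : ℝ}
    (ht : t ∈ Icc (0 : ℝ) 1) (hR : capacity (ν t) ≤ rate C) :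
    psi (rate C - capacity (ν t)) ≤ extrinsicMMSE C (ν t) i := by
  have hM := extrinsicMMSE_mem (ν := ν) hC i t
  have hl : 0 < log 2 := log_pos (by norm_num)
  have h1 := hν.condRate_sub_le (C := C) hN hC ht.1 ht.2 le_rfl
  have h2 := hν.condRate_le hN hC hsymm i ht
  rw [hν.condRate_one hN hC, hν.chanEntropy_one] at h1
  have hle : rate C - capacity (ν t) ≤
      1 + biasEnt (√(1 - extrinsicMMSE C (ν t) i)) / log 2 := by
    rw [capacity_eq]; linarith
  have hsq : √(1 - extrinsicMMSE C (ν t) i) ∈ Icc (-1 : ℝ) 1 :=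
    ⟨by linarith [sqrt_nonneg (1 - extrinsicMMSE C (ν t) i)],
      by rw [sqrt_le_one]; linarith [hM.1]⟩
  have hv : 1 + biasEnt (√(1 - extrinsicMMSE C (ν t) i)) / log 2 ≤ 1 := by
    have := div_nonpos_of_nonpos_of_nonneg (biasEnt_nonpos hsq) hl.le
    linarith
  have h0 : 0 ≤ rate C - capacity (ν t) := by linarith
  calc _ ≤ psi (1 + biasEnt (√(1 - extrinsicMMSE C (ν t) i)) / log 2) :=
        strictMonoOn_psi.monotoneOn ⟨h0, hle.trans hv⟩ ⟨h0.trans hle, hv⟩ hle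
    _ = _ := psi_biasEnt hM

end Family

end BMS

/-! ### The threshold and the two bounds. -/

theorem mainTheorem5 (ν : ℝ → MeasureTheory.Measure EReal)
    [∀ t, MeasureTheory.IsProbabilityMeasure (ν t)] (hν : BMS.IsAdmissibleFamily ν)
    (N : ℕ) (hN : 0 < N) (C : Finset (Fin N → Bool)) (hC : C.Nonempty)
    (hsymm : BMS.HasTransitiveSymmetry (BMS.codeLaw C)) (R : ℝ) (hR : R = BMS.rate C) :
    (∀ u ∈ Set.Icc (0 : ℝ) 1, 0 ≤ BMS.psi u) ∧ StrictMonoOn BMS.psi (Set.Icc 0 1) ∧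
    ∃ tR ∈ Set.Icc (0 : ℝ) 1,
      BMS.capacity (ν tR) = R ∧
      (∀ t ∈ Set.Icc (0 : ℝ) 1, BMS.capacity (ν t) = R → t = tR) ∧
      (0 < R → R < 1 → tR ∈ Set.Ioo (0 : ℝ) 1) ∧
      (∀ t ∈ Set.Ico 0 tR, R < BMS.capacity (ν t)) ∧
      (∀ t ∈ Set.Ioc tR 1, 0 < ∫ s in tR..t, BMS.psi (R - BMS.capacity (ν s))) ∧
      ∀ i : Fin N,
        IntervalIntegrable
          (fun s => BMS.extrinsicMMSE C (ν s) i * (1 - BMS.extrinsicMMSE C (ν s) i))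
          MeasureTheory.volume 0 1 ∧
        (∀ t ∈ Set.Ico 0 tR,
          ENNReal.ofReal (BMS.extrinsicMMSE C (ν t) i) ≤
            BMS.kappa ν t *
              ENNReal.ofReal (∫ s in t..1,
                BMS.extrinsicMMSE C (ν s) i * (1 - BMS.extrinsicMMSE C (ν s) i)) /
              ENNReal.ofReal (BMS.capacity (ν t) - R)) ∧
        (∀ t ∈ Set.Ioc tR 1,
          1 - (∫ s in tR..t,
                BMS.extrinsicMMSE C (ν s) i * (1 - BMS.extrinsicMMSE C (ν s) i)) /
              (∫ s in tR..t, BMS.psi (R - BMS.capacity (ν s))) ≤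
            BMS.extrinsicMMSE C (ν t) i) := by
  open BMS in
  have hRm : R ∈ Icc (0 : ℝ) 1 := hR ▸ rate_mem hN hC
  have hanti : StrictAntiOn (fun t => capacity (ν t)) (Icc 0 1) := fun s hs t ht hst => by
    have := hν.strictMonoOn_chanEntropy hs ht hst
    simp only [capacity_eq] at this ⊢
    linarith
  have hc0 : capacity (ν 0) = 1 := by rw [capacity_eq, hν.chanEntropy_zero, sub_zero]
  have hc1 : capacity (ν 1) = 0 := by rw [capacity_eq, hν.chanEntropy_one, sub_self]
  have hcont : ContinuousOn (fun t => capacity (ν t)) (Icc 0 1) := by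
    simp only [capacity_eq]
    exact continuousOn_const.sub hν.continuousOn_chanEntropy
  obtain ⟨tR, htR, hcR⟩ := intermediate_value_Icc' (zero_le_one (α := ℝ)) hcont
    (by simpa only [hc0, hc1] using hRm)
  simp only at hcR
  have hlt : ∀ t ∈ Ico 0 tR, R < capacity (ν t) := fun t ht => by
    have := hanti ⟨ht.1, ht.2.le.trans htR.2⟩ htR ht.2
    simp only at this
    linarith
  have hsub : ∀ s ∈ Icc tR 1, s ∈ Icc (0 : ℝ) 1 := fun s hs => ⟨htR.1.trans hs.1, hs.2⟩
  have hle : ∀ s ∈ Icc tR 1, R - capacity (ν s) ∈ Icc (0 : ℝ) 1 := fun s hs => by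
    have h1 := hanti.antitoneOn htR (hsub s hs) hs.1
    have h2 := hanti.antitoneOn (hsub s hs) (by simp) hs.2
    simp only [hc1] at h1 h2
    exact ⟨by linarith, by linarith [hRm.2]⟩
  have hψmono : MonotoneOn (fun s => psi (R - capacity (ν s))) (Icc tR 1) :=
    fun x hx y hy hxy => strictMonoOn_psi.monotoneOn (hle x hx) (hle y hy)
      (sub_le_sub_left (hanti.antitoneOn (hsub x hx) (hsub y hy) hxy) R)
  have hψint : ∀ t ∈ Ioc tR 1,
      IntervalIntegrable (fun s => psi (R - capacity (ν s))) volume tR t := fun t ht =>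
    MonotoneOn.intervalIntegrable (by
      rw [uIcc_of_le ht.1.le]; exact hψmono.mono (Icc_subset_Icc_right ht.2))
  have hpos : ∀ t ∈ Ioc tR 1, 0 < ∫ s in tR..t, psi (R - capacity (ν s)) := fun t ht => by
    refine intervalIntegral.intervalIntegral_pos_of_pos_on (hψint t ht) (fun s hs => ?_) ht.1
    have hs1 : s ∈ Icc tR 1 := ⟨hs.1.le, hs.2.le.trans ht.2⟩
    have h1 := hanti htR (hsub s hs1) hs.1
    simp only at h1
    exact (psi_nonneg (by simp)).trans_lt
      (strictMonoOn_psi (left_mem_Icc.2 zero_le_one) (hle s hs1) (by linarith))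
  refine ⟨fun u hu => psi_nonneg hu, strictMonoOn_psi, tR, htR, hcR,
    fun t ht h => hanti.injOn ht htR (h.trans hcR.symm), fun h0 h1 => ⟨?_, ?_⟩, hlt, hpos,
    fun i => ?_⟩
  · exact lt_of_le_of_ne htR.1 fun h => by rw [← h, hc0] at hcR; linarith
  · exact lt_of_le_of_ne htR.2 fun h => by rw [h, hc1] at hcR; linarith
  have hM := hν.monotoneOn_extrinsicMMSE hC i
  have hM01 : ∀ s ∈ Icc (0 : ℝ) 1, extrinsicMMSE C (ν s) i ∈ Icc (0 : ℝ) 1 :=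
    fun s _ => extrinsicMMSE_mem hC i s
  refine ⟨intervalIntegrable_mul_one_sub hM hM01 le_rfl zero_le_one le_rfl, fun t ht => ?_,
    fun t ht => ?_⟩
  · have ht' : t ∈ Icc (0 : ℝ) 1 := ⟨ht.1, ht.2.le.trans htR.2⟩
    have hcap : 0 < capacity (ν t) - R := sub_pos.2 (hlt t ht)
    rw [ENNReal.le_div_iff_mul_le (Or.inl (by simpa using hlt t ht))
      (Or.inl ENNReal.ofReal_ne_top), ← ENNReal.ofReal_mul (hM01 t ht').1]
    have hI := mul_integral_one_sub_le hM hM01 ht.1 ht'.2 le_rfl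
    by_cases hk : kappa ν t = ⊤
    · rw [hk]
      rcases lt_or_ge 0 (∫ s in t..1, extrinsicMMSE C (ν s) i * (1 - extrinsicMMSE C (ν s) i))
        with h | h
      · rw [ENNReal.top_mul (by simpa using h)]
        exact le_top
      · suffices h0 : extrinsicMMSE C (ν t) i = 0 by simp [h0]
        by_contra hne
        have hMt : 0 < extrinsicMMSE C (ν t) i := lt_of_le_of_ne (hM01 t ht').1 (Ne.symm hne)
        obtain ⟨s, hts, hsR⟩ := exists_between ht.2
        have hs : s ∈ Icc (0 : ℝ) 1 := ⟨ht.1.trans hts.le, hsR.le.trans htR.2⟩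
        have h1 : extrinsicMMSE C (ν s) i = 1 := by
          refine le_antisymm (hM01 s hs).2 ?_
          -- If M(s) < 1, monotonicity keeps 1 - M at least 1 - M(s) on [t,s], so its integral is
          -- positive.
          by_contra! hlt1
          have hint : IntervalIntegrable (fun s => 1 - extrinsicMMSE C (ν s) i) volume t 1 :=
            intervalIntegrable_const.sub (intervalIntegrable_of_monotoneOn hM ht.1 ht'.2 le_rfl)
          have hmono := intervalIntegral.integral_mono_interval le_rfl hts.le hs.2
            (Filter.Eventually.of_forall fun u =>
              sub_nonneg.2 (extrinsicMMSE_mem (ν := ν) hC i u).2) hint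
          have hconst : (s - t) * (1 - extrinsicMMSE C (ν s) i) ≤
              ∫ u in t..s, (1 - extrinsicMMSE C (ν u) i) := by
            rw [← smul_eq_mul, ← intervalIntegral.integral_const]
            refine intervalIntegral.integral_mono_on hts.le intervalIntegrable_const
              (intervalIntegrable_const.sub
                (intervalIntegrable_of_monotoneOn hM ht.1 hts.le hs.2)) fun u hu => ?_
            exact sub_le_sub_left (hM ⟨ht.1.trans hu.1, hu.2.trans hs.2⟩ hs hu.2) 1
          have := mul_pos (sub_pos.2 hts) (sub_pos.2 hlt1)
          nlinarith [mul_pos hMt (this.trans_le (hconst.trans hmono))]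
        -- With M(s) = 1 the entropy inequality from s to 1 gives C(s) ≤ R - h(s) ≤ R, contradicting
        -- s < t_R.
        have h2 := hν.le_condRate_sub hN hC hsymm i hs.1 hs.2 le_rfl
        rw [h1, hν.chanEntropy_one, hν.condRate_one hN hC, ← hR] at h2
        have h3 := hν.condRate_nonneg hN hC hsymm hs
        have h4 := hlt s ⟨hs.1, hsR⟩
        rw [capacity_eq] at h4
        linarith
    · rw [← ENNReal.ofReal_toReal hk, ← ENNReal.ofReal_mul ENNReal.toReal_nonneg]
      refine ENNReal.ofReal_le_ofReal ?_
      have h := hν.capacity_sub_rate_le hN hC hsymm i ht' hk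
      rw [← hR] at h
      calc _ ≤ extrinsicMMSE C (ν t) i *
            ((kappa ν t).toReal * ∫ s in t..1, (1 - extrinsicMMSE C (ν s) i)) :=
            mul_le_mul_of_nonneg_left h (hM01 t ht').1
        _ = (kappa ν t).toReal *
            (extrinsicMMSE C (ν t) i * ∫ s in t..1, (1 - extrinsicMMSE C (ν s) i)) := by ring
        _ ≤ _ := mul_le_mul_of_nonneg_left hI ENNReal.toReal_nonneg
  · have hJ := hpos t ht
    have ht' := hM01 t (hsub t ⟨ht.1.le, ht.2⟩)
    have h1 := one_sub_mul_integral_le hM hM01 htR.1 ht.1.le ht.2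
    have h2 : ∫ s in tR..t, psi (R - capacity (ν s)) ≤ ∫ s in tR..t, extrinsicMMSE C (ν s) i := by
      refine intervalIntegral.integral_mono_on ht.1.le (hψint t ht)
        (intervalIntegrable_of_monotoneOn hM htR.1 ht.1.le ht.2) fun s hs => ?_
      have hs1 : s ∈ Icc tR 1 := ⟨hs.1, hs.2.trans ht.2⟩
      rw [hR]
      refine hν.psi_le_extrinsicMMSE hN hC hsymm i (hsub s hs1) ?_
      rw [← hR]
      linarith [(hle s hs1).1]
    rw [sub_le_comm, le_div_iff₀ hJ]
    exact (mul_le_mul_of_nonneg_left h2 (by linarith [ht'.2])).trans h1
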